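/- Let $d\in\{2,3\}$, let $\Omega\subset\mathbb R^d$ be a bounded simply connected domain with $C^1$ boundary and outward unit normal $\nu$, and let $\sigma_c>0$ be a constant. For a symmetric positive definite constant matrix $\sigma_m$ (possibly anisotropic), a function $\beta\ge 0$ on $\partial\Omega$ and a unit vector $a\in\mathbb R^d$, consider with $\sigma=\sigma_c I\,\chi(\Omega)+\sigma_m\,\chi(\mathbb R^d\setminus\overline\Omega)$ the low conductivity (LC) type imperfect interface problem $$\nabla\cdot\sigma\nabla u=0\ \text{ in }\Omega\cup(\mathbb R^d\setminus\overline\Omega),\qquad \beta\,(u|_+-u|_-)=(\sigma_m\nabla u)|_+\cdot\nu,\quad \sigma_c\,\nabla u|_-\cdot\nu=(\sigma_m\nabla u)|_+\cdot\nu\ \text{ on }\partial\Omega,$$ $$u(x)-a\cdot x=O(|x|^{1-d})\ \text{ as }|x|\to\infty ,$$ where $\pm$ denote the limits at $\partial\Omega$ from outside and inside. Solutions are classical: $u$ is $C^2$ off $\partial\Omega$, and $u$ and $\nabla u$ have limits at every point of $\partial\Omega$ from either side. We say that $\Omega$ with the interface parameter $\beta$ is *neutral to all uniform fields* (for $\sigma_c,\sigma_m$)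 if for every unit vector $a$ the problem has a solution $u$ with $u(x)=a\cdot x$ for all $x\in\mathbb R^d\setminus\Omega$. Call $\sigma_m$ *admissible* if it is symmetric positive definite and $\sigma_m-\sigma_cI$ is either positive definite or negative definite. An ellipse ($d=2$) or ellipsoid ($d=3$) is a set $\{x:(x-x_0)\cdot P(x-x_0)<1\}$ with $x_0\in\mathbb R^d$ and $P$ symmetric positive definite. Then: 1. There are an admissible $\sigma_m$ and an interface parameter $\beta\ge0$ with which $\Omega$ is neutral to all uniform fields if and only if $\Omega$ is an ellipse ($d=2$) or an ellipsoid ($d=3$). 2. More precisely, for each admissible $\sigma_m$, there is an interface parameter $\beta\ge 0$ with which $\Omega$ is neutral to all uniform fields for $\sigma_c,\sigma_m$ if and only if $\sigma_cI-\sigma_m$ is positive definite and, for some $x_0\in\mathbb R^d$ and $t>0$, $$\Omega=\{x: t\,(x-x_0)\cdot(\sigma_m^{-1}-\sigma_c^{-1}I)(x-x_0)<1\}.$$ 3. If $\sigma_m=sI$ is isotropic with $s>0$, $s\ne\sigma_c$, and $\Omega$ with some $\beta\ge0$ is neutral to all uniform fields, then $\Omega$ is a disk ($d=2$) or a ball ($d=3$),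 and $\beta$ is constant on $\partial\Omega$. -/

import Mathlib

open Set Filter Topology Asymptotics
open scoped Matrix

noncomputable section

namespace LCInterface

/-- Euclidean space `ℝ^d`. -/
abbrev E (d : ℕ) : Type := EuclideanSpace ℝ (Fin d)

/-- The linear action of a real `d × d` matrix on `ℝ^d`. -/
def act {d : ℕ} (M : Matrix (Fin d) (Fin d) ℝ) (v : E d) : E d :=
  WithLp.toLp 2 (M *ᵥ v.ofLp)

/-- The divergence `∑ i, ∂ᵢ Fᵢ` of a vector field `F`. -/
def div {d : ℕ} (F : E d → E d) (x : E d) : ℝ :=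
  ∑ i : Fin d, (fderiv ℝ F x (EuclideanSpace.single i 1)) i

/-- The (open) exterior `ℝ^d ∖ closure Ω`. -/
def ext {d : ℕ} (Ω : Set (E d)) : Set (E d) := (closure Ω)ᶜ

/-- `ρ` is a local `C¹` defining function of `Ω` in the neighbourhood `U` of the boundary point
`x`: in `U`, the set `Ω` is `{ρ < 0}`, and `∇ρ(x) ≠ 0`. -/
structure IsLocalDefining {d : ℕ} (Ω : Set (E d)) (x : E d) (ρ : E d → ℝ) (U : Set (E d)) :
    Prop where
  isOpen : IsOpen U
  mem : x ∈ U
  contDiffOn : ContDiffOn ℝ 1 ρ U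
  gradient_ne_zero : gradient ρ x ≠ 0
  inter_eq : Ω ∩ U = {y ∈ U | ρ y < 0}

/-- `Ω` has a `C¹` boundary. -/
def HasC1Boundary {d : ℕ} (Ω : Set (E d)) : Prop :=
  ∀ x ∈ frontier Ω, ∃ ρ U, IsLocalDefining Ω x ρ U

/-- `n` is the outward unit normal vector `∇ρ(x) / |∇ρ(x)|` of `Ω` at its boundary point `x`. -/
def IsOutwardNormal {d : ℕ} (Ω : Set (E d)) (x n : E d) : Prop :=
  ∃ ρ U, IsLocalDefining Ω x ρ U ∧ n = ‖gradient ρ x‖⁻¹ • gradient ρ x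

open Classical in
/-- The piecewise constant conductivity `σ = σ_c χ(Ω) + σ_m χ(ℝ^d ∖ closure Ω)`, with an isotropic
core `σ_c` and a matrix conductivity `σ_m`. (Its values on `∂Ω` are irrelevant.) -/
def conductivity {d : ℕ} (Ω : Set (E d)) (σc : ℝ) (σm : Matrix (Fin d) (Fin d) ℝ) (x : E d) :
    Matrix (Fin d) (Fin d) ℝ :=
  if x ∈ Ω then σc • 1 else σm

/-- `u` is a solution of the low conductivity type imperfect interface problem with interface
parameter `β` and background field `a`. The solution is classical: `C²` off the interface, and `u`
and `∇u` have limits at every interface point from the inside and from the outside. -/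
structure IsLCSolution {d : ℕ} (Ω : Set (E d)) (σc : ℝ) (σm : Matrix (Fin d) (Fin d) ℝ)
    (β : E d → ℝ) (a : E d) (u : E d → ℝ) : Prop where
  contDiffOn : ContDiffOn ℝ 2 u (Ω ∪ ext Ω)
  equation : ∀ x ∈ Ω ∪ ext Ω,
    div (fun y => act (conductivity Ω σc σm y) (gradient u y)) x = 0
  interface : ∀ x ∈ frontier Ω, ∃ (um up : ℝ) (gm gp : E d),
    Tendsto u (𝓝[Ω] x) (𝓝 um) ∧ Tendsto u (𝓝[ext Ω] x) (𝓝 up) ∧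
    Tendsto (gradient u) (𝓝[Ω] x) (𝓝 gm) ∧ Tendsto (gradient u) (𝓝[ext Ω] x) (𝓝 gp) ∧
    ∀ n, IsOutwardNormal Ω x n →
      β x * (up - um) = inner ℝ (act σm gp) n ∧
      σc * inner ℝ gm n = inner ℝ (act σm gp) n
  decay : (fun x => u x - inner ℝ a x) =O[Bornology.cobounded (E d)]
    (fun x => ‖x‖ ^ (1 - (d : ℤ)))

/-- `Ω` with the interface parameter `β ≥ 0` is neutral to all uniform fields: for every unit
vector `a`, the problem has a solution which is unperturbed outside `Ω`. -/
def IsNeutral {d : ℕ} (Ω : Set (E d)) (σc : ℝ) (σm : Matrix (Fin d) (Fin d) ℝ)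
    (β : E d → ℝ) : Prop :=
  (∀ x ∈ frontier Ω, 0 ≤ β x) ∧
  ∀ a : E d, ‖a‖ = 1 →
    ∃ u : E d → ℝ, IsLCSolution Ω σc σm β a u ∧ ∀ x ∈ Ωᶜ, u x = inner ℝ a x

/-- The set `{x | (x - x₀) · P (x - x₀) < 1}`; a solid ellipsoid (ellipse if `d = 2`) with center
`x₀` when `P` is symmetric and positive definite. -/
def ellipsoid {d : ℕ} (x₀ : E d) (P : Matrix (Fin d) (Fin d) ℝ) : Set (E d) :=
  {x | inner ℝ (x - x₀) (act P (x - x₀)) < 1}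

/-- `Ω` is an ellipsoid (an ellipse if `d = 2`), of any center, axes and orientation. -/
def IsEllipsoid {d : ℕ} (Ω : Set (E d)) : Prop :=
  ∃ (x₀ : E d) (P : Matrix (Fin d) (Fin d) ℝ), P.PosDef ∧ Ω = ellipsoid x₀ P

/-- `σ_m - σ_c I` is either positive definite or negative definite. -/
def IsContrastDefinite {d : ℕ} (σc : ℝ) (σm : Matrix (Fin d) (Fin d) ℝ) : Prop :=
  (σm - σc • (1 : Matrix (Fin d) (Fin d) ℝ)).PosDef ∨
    (σc • (1 : Matrix (Fin d) (Fin d) ℝ) - σm).PosDef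

end LCInterface

end

/-! Let `u = a·x` outside `Ω`. The flux condition says that inside `u` has the same normal
derivative as the linear function `σc⁻¹ (σm a)·x`. The difference is harmonic with zero Neumann
data, hence constant, so `u` is affine in `Ω` (`HasC1Boundary.gradient_eq_zero`,
`IsLCSolution.eq_affine`). Inserting both traces in the jump condition for all basis vectors `a`
gives `n = β (A x - c)` on the boundary, where `A = σm⁻¹ - σc⁻¹ I` (`IsNeutral.exists_normal_eq`).
In particular `β > 0`.

Definite contrast makes `A` definite, so `A x - c = A (x - x₀)`. If `A` were negative definite, the
outward normal would point towards `x₀` everywhere, which fails at a farthest point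
(`not_forall_inner_neg`). So `A` is positive definite, `Ω` is star-shaped about `x₀`, and the known
normal determines the derivative of its gauge `g`. This makes `g(v)² / (v·Av)` locally constant on
the connected punctured space, and `Ω` is an ellipsoid (`hasFDerivAt_gauge`, `eq_ellipsoid`).

Conversely, on such an ellipsoid a piecewise affine `u` works with `β = 1/|A (x - x₀)|`
(`exists_isNeutral_ellipsoid`).

Neumann uniqueness is proved without surface integrals: the field is tested against cutoffs of
`-ρ/ε`, where `ρ` is a global `C¹` defining function, and the boundary layers where these vary have
mass bounded uniformly in `ε`. -/

namespace LCInterface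

/-! ### Outward normals and the two sides of the boundary -/

section Normals

variable {d : ℕ} {Ω : Set (E d)} {x n : E d} {ρ : E d → ℝ} {U : Set (E d)}

theorem IsLocalDefining.contDiffAt (h : IsLocalDefining Ω x ρ U) {y : E d} (hy : y ∈ U) :
    ContDiffAt ℝ 1 ρ y :=
  h.contDiffOn.contDiffAt (h.isOpen.mem_nhds hy)

theorem IsLocalDefining.differentiableAt (h : IsLocalDefining Ω x ρ U) {y : E d} (hy : y ∈ U) :
    DifferentiableAt ℝ ρ y :=
  (h.contDiffAt hy).differentiableAt one_ne_zero

theorem IsLocalDefining.neg_of_mem (h : IsLocalDefining Ω x ρ U) {y : E d} (hy : y ∈ U)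
    (hΩ : y ∈ Ω) : ρ y < 0 := by
  have : y ∈ Ω ∩ U := ⟨hΩ, hy⟩
  rw [h.inter_eq] at this
  exact this.2

theorem IsLocalDefining.mem_of_neg (h : IsLocalDefining Ω x ρ U) {y : E d} (hy : y ∈ U)
    (hρ : ρ y < 0) : y ∈ Ω := by
  have : y ∈ {y ∈ U | ρ y < 0} := ⟨hy, hρ⟩
  rw [← h.inter_eq] at this
  exact this.1

theorem IsLocalDefining.mem_ext_of_pos (h : IsLocalDefining Ω x ρ U) {y : E d} (hy : y ∈ U)
    (hρ : 0 < ρ y) : y ∈ ext Ω := by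
  have hc : ContinuousAt ρ y := (h.contDiffAt hy).continuousAt
  have hev : ∀ᶠ z in 𝓝 y, z ∉ Ω := by
    filter_upwards [hc.eventually (lt_mem_nhds hρ), h.isOpen.mem_nhds hy] with z hz hzU hzΩ
    exact absurd (h.neg_of_mem hzU hzΩ) (not_lt.2 hz.le)
  intro hcl
  exact (mem_closure_iff_frequently.1 hcl) hev

theorem IsLocalDefining.eq_zero_of_mem_frontier (h : IsLocalDefining Ω x ρ U) (hopen : IsOpen Ω)
    {y : E d} (hy : y ∈ U) (hf : y ∈ frontier Ω) : ρ y = 0 := by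
  rw [hopen.frontier_eq] at hf
  refine le_antisymm (not_lt.1 fun hpos => ?_) (not_lt.1 fun hneg => hf.2 (h.mem_of_neg hy hneg))
  exact h.mem_ext_of_pos hy hpos hf.1

/-- A smaller neighbourhood in which the gradient of a local defining function does not vanish. -/
theorem IsLocalDefining.exists_forall (h : IsLocalDefining Ω x ρ U) :
    ∃ V, x ∈ V ∧ ∀ y ∈ V, IsLocalDefining Ω y ρ V := by
  have hg : ContinuousOn (gradient ρ) U := by
    have := h.contDiffOn.continuousOn_fderiv_of_isOpen h.isOpen le_rfl
    exact (InnerProductSpace.toDual ℝ (E d)).symm.continuous.comp_continuousOn this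
  have hV : IsOpen (U ∩ gradient ρ ⁻¹' {0}ᶜ) :=
    hg.isOpen_inter_preimage h.isOpen isOpen_compl_singleton
  refine ⟨U ∩ gradient ρ ⁻¹' {0}ᶜ, ⟨h.mem, h.gradient_ne_zero⟩, fun y hy => ?_⟩
  refine ⟨hV, hy, h.contDiffOn.mono inter_subset_left, hy.2, ?_⟩
  ext z
  constructor
  · rintro ⟨hz, hzU⟩
    exact ⟨hzU, h.neg_of_mem hzU.1 hz⟩
  · rintro ⟨hzU, hz⟩
    exact ⟨h.mem_of_neg hzU.1 hz, hzU⟩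

theorem IsOutwardNormal.norm_eq_one (h : IsOutwardNormal Ω x n) : ‖n‖ = 1 := by
  obtain ⟨ρ, U, hρ, rfl⟩ := h
  rw [norm_smul, norm_inv, norm_norm, inv_mul_cancel₀ (norm_ne_zero_iff.2 hρ.gradient_ne_zero)]

theorem IsOutwardNormal.ne_zero (h : IsOutwardNormal Ω x n) : n ≠ 0 := by
  rintro rfl
  simpa using h.norm_eq_one

theorem HasC1Boundary.exists_isOutwardNormal (h : HasC1Boundary Ω) (hx : x ∈ frontier Ω) :
    ∃ n, IsOutwardNormal Ω x n := by
  obtain ⟨ρ, U, hρ⟩ := h x hx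
  exact ⟨_, ρ, U, hρ, rfl⟩

/-- Near a boundary point, `Ω` contains all thin cones about the inward direction, and the exterior
contains all thin cones about the outward direction. -/
theorem IsOutwardNormal.eventually_cone (h : IsOutwardNormal Ω x n) (hopen : IsOpen Ω)
    (hx : x ∈ frontier Ω) {κ : ℝ} (hκ : 0 < κ) :
    ∀ᶠ y in 𝓝 x, (inner ℝ n (y - x) < -(κ * ‖y - x‖) → y ∈ Ω) ∧
      (κ * ‖y - x‖ < inner ℝ n (y - x) → y ∈ ext Ω) := by
  obtain ⟨ρ, U, hρ, rfl⟩ := h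
  have hpos : 0 < ‖gradient ρ x‖ := norm_pos_iff.2 hρ.gradient_ne_zero
  have h0 := hρ.eq_zero_of_mem_frontier hopen hρ.mem hx
  have hd := hasGradientAt_iff_isLittleO.1 (hρ.differentiableAt hρ.mem).hasGradientAt
  filter_upwards [hd.def (mul_pos hκ hpos), hρ.isOpen.mem_nhds hρ.mem] with y hy hyU
  rw [h0, sub_zero, Real.norm_eq_abs, abs_le] at hy
  have key : inner ℝ (‖gradient ρ x‖⁻¹ • gradient ρ x) (y - x) * ‖gradient ρ x‖
      = inner ℝ (gradient ρ x) (y - x) := by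
    rw [real_inner_smul_left]; field_simp
  constructor
  · intro hlt
    have := mul_lt_mul_of_pos_right hlt hpos
    rw [key] at this
    exact hρ.mem_of_neg hyU (by nlinarith [hy.2])
  · intro hlt
    have := mul_lt_mul_of_pos_right hlt hpos
    rw [key] at this
    exact hρ.mem_ext_of_pos hyU (by nlinarith [hy.1])

theorem tendsto_add_smul_nhdsGT (x v : E d) :
    Tendsto (fun t : ℝ => x + t • v) (𝓝[>] 0) (𝓝 x) := by
  have : Continuous fun t : ℝ => x + t • v := by fun_prop
  exact (by simpa using this.tendsto 0 : Tendsto (fun t : ℝ => x + t • v) (𝓝 0) (𝓝 x)).mono_left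
    nhdsWithin_le_nhds

theorem IsOutwardNormal.eventually_mem (h : IsOutwardNormal Ω x n) (hopen : IsOpen Ω)
    (hx : x ∈ frontier Ω) {v : E d} (hv : inner ℝ n v < 0) :
    ∀ᶠ t in 𝓝[>] (0 : ℝ), x + t • v ∈ Ω := by
  have hv0 : 0 < ‖v‖ := norm_pos_iff.2 (by rintro rfl; simp at hv)
  have hκ : 0 < -inner ℝ n v / (2 * ‖v‖) := by apply div_pos <;> linarith
  filter_upwards [(tendsto_add_smul_nhdsGT x v).eventually (h.eventually_cone hopen hx hκ),
    self_mem_nhdsWithin] with t ht htpos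
  have htpos : 0 < t := htpos
  refine ht.1 ?_
  rw [add_sub_cancel_left, real_inner_smul_right, norm_smul, Real.norm_of_nonneg htpos.le]
  have : -inner ℝ n v / (2 * ‖v‖) * (t * ‖v‖) = t * (-inner ℝ n v / 2) := by field_simp
  rw [this]
  nlinarith

theorem IsOutwardNormal.eventually_mem_ext (h : IsOutwardNormal Ω x n) (hopen : IsOpen Ω)
    (hx : x ∈ frontier Ω) {v : E d} (hv : 0 < inner ℝ n v) :
    ∀ᶠ t in 𝓝[>] (0 : ℝ), x + t • v ∈ ext Ω := by
  have hv0 : 0 < ‖v‖ := norm_pos_iff.2 (by rintro rfl; simp at hv)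
  have hκ : 0 < inner ℝ n v / (2 * ‖v‖) := by apply div_pos <;> linarith
  filter_upwards [(tendsto_add_smul_nhdsGT x v).eventually (h.eventually_cone hopen hx hκ),
    self_mem_nhdsWithin] with t ht htpos
  have htpos : 0 < t := htpos
  refine ht.2 ?_
  rw [add_sub_cancel_left, real_inner_smul_right, norm_smul, Real.norm_of_nonneg htpos.le]
  have : inner ℝ n v / (2 * ‖v‖) * (t * ‖v‖) = t * (inner ℝ n v / 2) := by field_simp
  rw [this]
  nlinarith

theorem disjoint_ext (Ω : Set (E d)) : Disjoint Ω (ext Ω) :=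
  disjoint_left.2 fun _ hx hx' => hx' (subset_closure hx)

/-- If the two unit vectors differed, the direction `m - n` would enter `Ω` according to `n` and
leave it according to `m`. -/
theorem IsOutwardNormal.unique {m : E d} (h : IsOutwardNormal Ω x n) (h' : IsOutwardNormal Ω x m)
    (hopen : IsOpen Ω) (hx : x ∈ frontier Ω) : n = m := by
  by_contra hne
  have hlt : inner ℝ n m < (1 : ℝ) :=
    (inner_lt_one_iff_real_of_norm_eq_one h.norm_eq_one h'.norm_eq_one).2 hne
  have h1 : inner ℝ n (m - n) < (0 : ℝ) := by
    rw [inner_sub_right, real_inner_self_eq_norm_sq, h.norm_eq_one]; linarith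
  have h2 : 0 < inner ℝ m (m - n) := by
    rw [inner_sub_right, real_inner_self_eq_norm_sq, h'.norm_eq_one, real_inner_comm]; linarith
  obtain ⟨t, ht⟩ := ((h.eventually_mem hopen hx h1).and (h'.eventually_mem_ext hopen hx h2)).exists
  exact disjoint_left.1 (disjoint_ext Ω) ht.1 ht.2

theorem nhdsWithin_neBot (hx : x ∈ frontier Ω) : (𝓝[Ω] x).NeBot :=
  mem_closure_iff_nhdsWithin_neBot.1 (frontier_subset_closure hx)

theorem IsOutwardNormal.nhdsWithin_ext_neBot (h : IsOutwardNormal Ω x n) (hopen : IsOpen Ω)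
    (hx : x ∈ frontier Ω) : (𝓝[ext Ω] x).NeBot := by
  have h1 : 0 < inner ℝ n n := real_inner_self_pos.2 h.ne_zero
  refine mem_closure_iff_nhdsWithin_neBot.1 ?_
  exact mem_closure_of_tendsto (tendsto_add_smul_nhdsGT x n) (h.eventually_mem_ext hopen hx h1)

end Normals

/-! ### A global defining function and a transversal field -/

section GlobalDefining

open scoped Manifold ContDiff

variable {d : ℕ} {Ω : Set (E d)}

/-- `ρ` is a global `C¹` defining function of `Ω`, in so far as `closure Ω` is concerned. -/
structure IsGlobalDefining (Ω : Set (E d)) (ρ : E d → ℝ) : Prop where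
  contDiff : ContDiff ℝ 1 ρ
  neg : ∀ x ∈ Ω, ρ x < 0
  eq_zero : ∀ x ∈ frontier Ω, ρ x = 0
  gradient_eq : ∀ x ∈ frontier Ω, ∃ n, IsOutwardNormal Ω x n ∧ ∃ k : ℝ, 0 < k ∧ gradient ρ x = k • n

theorem contDiff_mul_of_tsupport_subset {f g : E d → ℝ} {U : Set (E d)} (hU : IsOpen U)
    (hf : ContDiff ℝ 1 f) (hg : ContDiffOn ℝ 1 g U) (hfU : tsupport f ⊆ U) :
    ContDiff ℝ 1 fun x => f x * g x := by
  refine contDiff_iff_contDiffAt.2 fun x => ?_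
  by_cases hx : x ∈ tsupport f
  · exact hf.contDiffAt.mul (hg.contDiffAt (hU.mem_nhds (hfU hx)))
  · refine contDiffAt_const (c := (0 : ℝ)) |>.congr_of_eventuallyEq ?_
    filter_upwards [notMem_tsupport_iff_eventuallyEq.1 hx] with y hy
    simp [hy]

theorem HasC1Boundary.exists_isGlobalDefining (hC1 : HasC1Boundary Ω) (hopen : IsOpen Ω)
    (hbdd : Bornology.IsBounded Ω) : ∃ ρ, IsGlobalDefining Ω ρ := by
  have hK : IsCompact (frontier Ω) :=
    hbdd.isCompact_closure.of_isClosed_subset isClosed_frontier frontier_subset_closure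
  have hloc : ∀ x : frontier Ω, ∃ (ρ : E d → ℝ) (V : Set (E d)), (x : E d) ∈ V ∧
      ∀ y ∈ V, IsLocalDefining Ω y ρ V := by
    rintro ⟨x, hx⟩
    obtain ⟨ρ, U, h⟩ := hC1 x hx
    exact ⟨ρ, h.exists_forall⟩
  choose r V hxV hV using hloc
  have hVo : ∀ i, IsOpen (V i) := fun i => (hV i i (hxV i)).isOpen
  obtain ⟨T, hT⟩ := hK.elim_finite_subcover V hVo fun x hx => mem_iUnion.2 ⟨⟨x, hx⟩, hxV _⟩
  obtain ⟨χ, hχ⟩ := SmoothPartitionOfUnity.exists_isSubordinate 𝓘(ℝ, E d) isClosed_frontier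
    (fun i : T => V i) (fun i => hVo i) (hT.trans (by
      intro x hx
      simp only [mem_iUnion] at hx ⊢
      obtain ⟨i, hi, hx⟩ := hx
      exact ⟨⟨i, hi⟩, hx⟩))
  have hχs : ∀ i, ContDiff ℝ 1 (χ i) := fun i =>
    (χ i).contMDiff.contDiff.of_le (by exact_mod_cast le_top)
  have hsum : ∀ x ∈ frontier Ω, ∑ i, χ i x = 1 := fun x hx => by
    rw [← finsum_eq_sum_of_fintype]; exact χ.sum_eq_one hx
  have hmem : ∀ i x, χ i x ≠ 0 → x ∈ V i := fun i x hx => hχ i (subset_tsupport _ hx)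
  have hprod : ∀ i : T, ContDiff ℝ 1 fun x => χ i x * r i x := fun i =>
    contDiff_mul_of_tsupport_subset (hVo i) (hχs i) (hV i i (hxV i)).contDiffOn (hχ i)
  -- The glued sum vanishes where every `χ i` does, possibly inside `Ω`. The subtracted square
  -- restores negativity there, and has zero value and gradient on the frontier, where the partition
  -- sums to one.
  refine ⟨fun x => ∑ i, χ i x * r i x - (1 - ∑ i, χ i x) ^ 2, ?_, ?_, ?_, ?_⟩
  · exact (ContDiff.sum fun i _ => hprod i).sub
      ((contDiff_const.sub (ContDiff.sum fun i _ => hχs i)).pow 2)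
  · intro x hx
    have hle : ∀ i ∈ Finset.univ, χ i x * r i x ≤ 0 := fun i _ => by
      by_cases h : χ i x = 0
      · simp [h]
      · exact mul_nonpos_of_nonneg_of_nonpos (χ.nonneg i x)
          ((hV i x (hmem i x h)).neg_of_mem (hmem i x h) hx).le
    by_cases h : ∃ i, χ i x ≠ 0
    · obtain ⟨i, hi⟩ := h
      have hpos : 0 < χ i x := lt_of_le_of_ne (χ.nonneg i x) hi.symm
      have := Finset.sum_lt_sum hle ⟨i, Finset.mem_univ i, mul_neg_of_pos_of_neg hpos
        ((hV i x (hmem i x hi)).neg_of_mem (hmem i x hi) hx)⟩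
      rw [Finset.sum_const_zero] at this
      nlinarith [sq_nonneg (1 - ∑ i, χ i x)]
    · push Not at h
      simp [h]
  · intro x hx
    have : ∀ i, χ i x * r i x = 0 := fun i => by
      by_cases h : χ i x = 0
      · simp [h]
      · rw [(hV i x (hmem i x h)).eq_zero_of_mem_frontier hopen (hmem i x h) hx, mul_zero]
    simp only [this, hsum x hx]
    simp
  · intro x hx
    obtain ⟨n, hn⟩ := hC1.exists_isOutwardNormal hx
    -- On the frontier `r i` vanishes, so only `χ i` times the gradient of `r i` survives. By
    -- uniqueness of the normal these gradients are all positive multiples of the same `n` and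
    -- cannot cancel.
    have hterm : ∀ i : T, ∃ k : ℝ, 0 ≤ k ∧ (χ i x ≠ 0 → 0 < k) ∧
        HasFDerivAt (fun y => χ i y * r i y) (k • innerSL ℝ n) x := by
      intro i
      by_cases h : χ i x = 0
      · refine ⟨0, le_rfl, fun h' => absurd h h', ?_⟩
        have hc := (hprod i).differentiable one_ne_zero x
        by_cases hxi : x ∈ V i
        · have h1 := ((hχs i).differentiable one_ne_zero x).hasFDerivAt.mul
            ((hV i x hxi).differentiableAt hxi).hasFDerivAt
          have h0 := (hV i x hxi).eq_zero_of_mem_frontier hopen hxi hx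
          refine h1.congr_fderiv ?_
          simp [h, h0]
        · have : x ∉ tsupport (χ i) := fun hx' => hxi (hχ i hx')
          have hev : (fun y => χ i y * r i y) =ᶠ[𝓝 x] fun _ => 0 := by
            filter_upwards [notMem_tsupport_iff_eventuallyEq.1 this] with y hy
            simp [hy]
          simpa using (hasFDerivAt_const (0 : ℝ) x).congr_of_eventuallyEq hev
      · have hxi := hmem i x h
        have hpos : 0 < χ i x := lt_of_le_of_ne (χ.nonneg i x) (Ne.symm h)
        have hL := hV i x hxi
        have hg : 0 < ‖gradient (r i) x‖ := norm_pos_iff.2 hL.gradient_ne_zero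
        have hni : n = ‖gradient (r i) x‖⁻¹ • gradient (r i) x :=
          hn.unique ⟨_, _, hL, rfl⟩ hopen hx
        have hgi : gradient (r i) x = ‖gradient (r i) x‖ • n := by
          rw [hni]; simp [smul_smul, hg.ne']
        refine ⟨χ i x * ‖gradient (r i) x‖, by positivity, fun _ => by positivity, ?_⟩
        have h1 := ((hχs i).differentiable one_ne_zero x).hasFDerivAt.mul
            (hL.differentiableAt hxi).hasFDerivAt
        have h0 := hL.eq_zero_of_mem_frontier hopen hxi hx
        refine h1.congr_fderiv ?_
        ext v
        rw [h0, zero_smul, add_zero, mul_smul]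
        simp only [smul_apply, innerSL_apply_apply, smul_eq_mul]
        rw [← inner_gradient_left, hgi, real_inner_smul_left, norm_smul, norm_norm,
          hn.norm_eq_one, mul_one]
    choose k hk0 hkpos hk using hterm
    refine ⟨n, hn, ∑ i, k i, ?_, ?_⟩
    · have : ∃ i, χ i x ≠ 0 := by
        by_contra! h
        simpa [h] using hsum x hx
      obtain ⟨i, hi⟩ := this
      exact Finset.sum_pos' (fun i _ => hk0 i) ⟨i, Finset.mem_univ i, hkpos i hi⟩
    · refine HasGradientAt.gradient ?_
      rw [hasGradientAt_iff_hasFDerivAt]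
      have h1 : HasFDerivAt (fun y => ∑ i, χ i y) (∑ i, fderiv ℝ (χ i) x) x :=
        HasFDerivAt.fun_sum fun i _ => ((hχs i).differentiable one_ne_zero x).hasFDerivAt
      have h2 := (HasFDerivAt.fun_sum fun i (_ : i ∈ Finset.univ) => hk i).sub
        ((h1.const_sub 1).pow 2)
      refine h2.congr_fderiv ?_
      rw [hsum x hx]
      ext v
      simp [Finset.sum_mul]

/-- A smooth vector field that is transversal to the boundary of `Ω`. -/
theorem IsGlobalDefining.exists_transversal {ρ : E d → ℝ} (hρ : IsGlobalDefining Ω ρ) :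
    ∃ X : E d → E d, ContDiff ℝ 1 X ∧ ∀ x ∈ frontier Ω, 0 < inner ℝ (gradient ρ x) (X x) := by
  have hg : Continuous (gradient ρ) :=
    (InnerProductSpace.toDual ℝ (E d)).symm.continuous.comp
      (hρ.contDiff.continuous_fderiv one_ne_zero)
  -- `gradient ρ` is transversal but only continuous, so it has no divergence. The admissible values
  -- at each point form a convex set and the constant `gradient ρ x` stays admissible near `x`, so a
  -- smooth selection exists.
  obtain ⟨X, hX⟩ := exists_contMDiffMap_forall_mem_convex_of_local_const (n := 1) 𝓘(ℝ, E d)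
    (t := fun x => {v : E d | x ∈ frontier Ω → 0 < inner ℝ (gradient ρ x) v}) (fun x => by
      intro v hv w hw a b ha hb hab hx
      have h1 := hv hx
      have h2 := hw hx
      rw [inner_add_right, real_inner_smul_right, real_inner_smul_right]
      rcases ha.eq_or_lt with rfl | ha
      · have : b = 1 := by linarith
        simpa [this] using h2
      · have := mul_pos ha h1
        have := mul_nonneg hb h2.le
        linarith) (fun x => by
      by_cases hx : x ∈ frontier Ω
      · refine ⟨gradient ρ x, ?_⟩
        have h0 : 0 < inner ℝ (gradient ρ x) (gradient ρ x) := by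
          obtain ⟨n, hn, k, hk, h⟩ := hρ.gradient_eq x hx
          rw [real_inner_self_pos, h]
          exact smul_ne_zero hk.ne' hn.ne_zero
        have hc : Continuous fun y => inner ℝ (gradient ρ y) (gradient ρ x) :=
          hg.inner continuous_const
        filter_upwards [hc.continuousAt.eventually (lt_mem_nhds h0)] with y hy _ using hy
      · refine ⟨0, ?_⟩
        filter_upwards [isClosed_frontier.isOpen_compl.mem_nhds hx] with y hy hy'
        exact absurd hy' hy)
  exact ⟨X, X.contMDiff.contDiff, hX⟩

end GlobalDefining

/-! ### Integration by parts with boundary layers, and Neumann uniqueness -/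

section Divergence

open MeasureTheory

variable {d : ℕ} {Ω : Set (E d)} {ρ : E d → ℝ}

theorem div_congr {F G : E d → E d} {x : E d} (h : F =ᶠ[𝓝 x] G) : div F x = div G x := by
  unfold div
  rw [h.fderiv_eq]

theorem continuousOn_div {F : E d → E d} (hopen : IsOpen Ω) (hF : ContDiffOn ℝ 1 F Ω) :
    ContinuousOn (div F) Ω := by
  have hc := hF.continuousOn_fderiv_of_isOpen hopen le_rfl
  refine continuousOn_finsetSum _ fun i _ => ?_
  have h1 : ContinuousOn (fun x => fderiv ℝ F x (EuclideanSpace.single i 1)) Ω :=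
    hc.clm_apply continuousOn_const
  exact (EuclideanSpace.proj (𝕜 := ℝ) i).continuous.comp_continuousOn h1

theorem sum_mul_apply_single (L : E d →L[ℝ] ℝ) (v : E d) :
    ∑ i, L (EuclideanSpace.single i 1) * v i = L v := by
  conv_rhs => rw [← (EuclideanSpace.basisFun (Fin d) ℝ).sum_repr v]
  simp [mul_comm]

theorem div_smul {φ : E d → ℝ} {F : E d → E d} {x : E d} (hφ : DifferentiableAt ℝ φ x)
    (hF : DifferentiableAt ℝ F x) :
    div (fun y => φ y • F y) x = φ x * div F x + inner ℝ (gradient φ x) (F x) := by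
  unfold div
  have h : fderiv ℝ (fun y => φ y • F y) x = φ x • fderiv ℝ F x + (fderiv ℝ φ x).smulRight (F x) :=
    (hφ.hasFDerivAt.smul hF.hasFDerivAt).fderiv
  rw [h, inner_gradient_left, ← sum_mul_apply_single,
    Finset.mul_sum, ← Finset.sum_add_distrib]
  simp

theorem integral_div_eq_zero {G : E d → E d} (hG : ContDiff ℝ 1 G) (hs : HasCompactSupport G) :
    ∫ x, div G x = 0 := by
  have hcoord : ∀ i x v, fderiv ℝ (fun y => G y i) x v = (fderiv ℝ G x v) i := fun i x v => by
    have h := (EuclideanSpace.proj (𝕜 := ℝ) i).hasFDerivAt.comp x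
      (hG.differentiable one_ne_zero x).hasFDerivAt
    exact congrArg (fun L => L v) h.fderiv
  have hGi : ∀ i, ContDiff ℝ 1 fun y => G y i := fun i =>
    (EuclideanSpace.proj (𝕜 := ℝ) i).contDiff.comp hG
  have hsi : ∀ i, HasCompactSupport fun y => G y i := fun i =>
    hs.comp_left (g := fun v : E d => v i) rfl
  have hint : ∀ i v, Integrable fun x => fderiv ℝ (fun y => G y i) x v := fun i v =>
    (((hGi i).continuous_fderiv one_ne_zero).clm_apply continuous_const).integrable_of_hasCompactSupport
      ((hsi i).fderiv_apply (𝕜 := ℝ) v)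
  unfold div
  simp_rw [← hcoord]
  rw [integral_finsetSum _ fun i _ => hint i _]
  refine Finset.sum_eq_zero fun i _ => ?_
  have := integral_mul_fderiv_eq_neg_fderiv_mul_of_integrable (μ := volume) (𝕜 := ℝ)
    (f := fun _ => (1 : ℝ)) (g := fun y => G y i) (v := EuclideanSpace.single i 1)
    (by simp) (by simpa using hint i _)
    (by simpa using (hGi i).continuous.integrable_of_hasCompactSupport (hsi i))
    (fun _ _ => differentiableAt_const _) (fun x _ => (hGi i).differentiable one_ne_zero x)
  simpa using this

/-- The extension by zero is `C¹` with compact support on the whole space, because `f` already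
vanishes near the boundary of `Ω`. -/
theorem setIntegral_div_eq_zero {f : E d → E d} {K : Set (E d)} (hopen : IsOpen Ω)
    (hf : ContDiffOn ℝ 1 f Ω) (hK : IsCompact K) (hKΩ : K ⊆ Ω) (h0 : ∀ x ∈ Ω \ K, f x = 0) :
    ∫ x in Ω, div f x = 0 := by
  have hout : ∀ x ∉ K, Ω.indicator f x = 0 := fun x hx => by
    by_cases hxΩ : x ∈ Ω
    · rw [indicator_of_mem hxΩ, h0 x ⟨hxΩ, hx⟩]
    · exact indicator_of_notMem hxΩ f
  have hev : ∀ x ∉ K, Ω.indicator f =ᶠ[𝓝 x] fun _ => 0 := fun x hx => by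
    filter_upwards [hK.isClosed.isOpen_compl.mem_nhds hx] with y hy using hout y hy
  have hin : ∀ x ∈ Ω, Ω.indicator f =ᶠ[𝓝 x] f := fun x hx => by
    filter_upwards [hopen.mem_nhds hx] with y hy using indicator_of_mem hy f
  have hG : ContDiff ℝ 1 (Ω.indicator f) := contDiff_iff_contDiffAt.2 fun x => by
    by_cases hx : x ∈ K
    · exact (hf.contDiffAt (hopen.mem_nhds (hKΩ hx))).congr_of_eventuallyEq (hin x (hKΩ hx))
    · exact contDiffAt_const.congr_of_eventuallyEq (hev x hx)
  have hz := integral_div_eq_zero hG (HasCompactSupport.intro hK hout)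
  have h1 : ∀ x ∉ Ω, div (Ω.indicator f) x = 0 := fun x hx => by
    rw [div_congr (hev x fun h => hx (hKΩ h))]
    simp [div]
  rw [← setIntegral_eq_integral_of_forall_compl_eq_zero h1] at hz
  rw [← hz]
  exact setIntegral_congr_fun hopen.measurableSet fun x hx => (div_congr (hin x hx)).symm

theorem integrableOn_of_eq_zero_off_compact {f : E d → ℝ} {K : Set (E d)} (hopen : IsOpen Ω)
    (hf : ContinuousOn f Ω) (hK : IsCompact K) (hKΩ : K ⊆ Ω) (h0 : ∀ x ∈ Ω \ K, f x = 0) :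
    IntegrableOn f Ω :=
  ((hf.mono hKΩ).integrableOn_compact hK).of_forall_sdiff_eq_zero hopen.measurableSet h0

theorem IsGlobalDefining.isCompact_inner (hρ : IsGlobalDefining Ω ρ)
    (hbdd : Bornology.IsBounded Ω) (ε : ℝ) : IsCompact (closure Ω ∩ {x | ε ≤ -ρ x}) :=
  hbdd.isCompact_closure.inter_right
    (isClosed_le continuous_const hρ.contDiff.continuous.neg)

theorem mem_of_mem_closure_of_notMem_frontier (hopen : IsOpen Ω) {x : E d} (hx : x ∈ closure Ω)
    (hf : x ∉ frontier Ω) : x ∈ Ω := by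
  rw [hopen.frontier_eq] at hf
  by_contra h
  exact hf ⟨hx, h⟩

theorem IsGlobalDefining.inner_subset (hρ : IsGlobalDefining Ω ρ) (hopen : IsOpen Ω) {ε : ℝ}
    (hε : 0 < ε) : closure Ω ∩ {x | ε ≤ -ρ x} ⊆ Ω := by
  rintro x ⟨hx, hxε⟩
  refine mem_of_mem_closure_of_notMem_frontier hopen hx fun hf => ?_
  have hxε : ε ≤ -ρ x := hxε
  rw [hρ.eq_zero x hf] at hxε
  linarith

/-- A property that holds near each boundary point, inside `Ω`, holds in a boundary layer. -/
theorem IsGlobalDefining.exists_layer (hρ : IsGlobalDefining Ω ρ) (hopen : IsOpen Ω)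
    (hbdd : Bornology.IsBounded Ω) {p : E d → Prop}
    (hp : ∀ x ∈ frontier Ω, ∀ᶠ y in 𝓝[Ω] x, p y) :
    ∃ δ > 0, ∀ x ∈ Ω, -ρ x < δ → p x := by
  -- This compact set contains every point of `Ω` where `p` fails and avoids the frontier, so `-ρ`
  -- has a positive minimum on it.
  have hC : IsCompact (closure Ω \ interior {y | y ∈ Ω → p y}) :=
    hbdd.isCompact_closure.diff isOpen_interior
  have hCΩ : closure Ω \ interior {y | y ∈ Ω → p y} ⊆ Ω := by
    rintro x ⟨hx, hxi⟩
    refine mem_of_mem_closure_of_notMem_frontier hopen hx fun hf => hxi ?_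
    exact mem_interior_iff_mem_nhds.2 (eventually_nhdsWithin_iff.1 (hp x hf))
  rcases (closure Ω \ interior {y | y ∈ Ω → p y}).eq_empty_or_nonempty with he | hne
  · refine ⟨1, one_pos, fun x hx _ => ?_⟩
    exact (interior_subset (sdiff_eq_empty.1 he (subset_closure hx)) :) hx
  · obtain ⟨z, hz, hmin⟩ := hC.exists_isMinOn hne hρ.contDiff.continuous.neg.continuousOn
    refine ⟨-ρ z, neg_pos.2 (hρ.neg z (hCΩ hz)), fun x hx hlt => ?_⟩
    by_contra hpx
    have : -ρ z ≤ -ρ x := hmin ⟨subset_closure hx, fun h => hpx ((interior_subset h :) hx)⟩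
    linarith

/-- A smooth step function, equal to `0` on `(-∞, 1]` and to `1` on `[2, ∞)`. -/
noncomputable def step (s : ℝ) : ℝ := Real.smoothTransition (s - 1)

theorem contDiff_step : ContDiff ℝ 2 step :=
  (Real.smoothTransition.contDiff (n := 2)).comp (contDiff_id.sub contDiff_const)

theorem monotone_step : Monotone step := fun _ _ h =>
  Real.smoothTransition.monotone (sub_le_sub_right h 1)

theorem step_eq_zero {s : ℝ} (hs : s ≤ 1) : step s = 0 :=
  Real.smoothTransition.zero_of_nonpos (by linarith)

theorem step_eq_one {s : ℝ} (hs : 2 ≤ s) : step s = 1 :=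
  Real.smoothTransition.one_of_one_le (by linarith)

theorem deriv_step_eq_zero_of_lt {s : ℝ} (hs : s < 1) : deriv step s = 0 := by
  have : step =ᶠ[𝓝 s] fun _ => 0 := by
    filter_upwards [gt_mem_nhds hs] with t ht using step_eq_zero (le_of_lt ht)
  rw [this.deriv_eq, deriv_const]

theorem deriv_step_eq_zero_of_gt {s : ℝ} (hs : 2 < s) : deriv step s = 0 := by
  have : step =ᶠ[𝓝 s] fun _ => 1 := by
    filter_upwards [lt_mem_nhds hs] with t ht using step_eq_one (le_of_lt ht)
  rw [this.deriv_eq, deriv_const]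

/-- The inner cutoff at depth between `ε` and `2ε`, measured by `-ρ`. -/
noncomputable def cutoff (ρ : E d → ℝ) (ε : ℝ) (x : E d) : ℝ := step (-ρ x / ε)

/-- The density of the boundary layer in which the inner cutoff varies. -/
noncomputable def layerDensity (ρ : E d → ℝ) (ε : ℝ) (x : E d) : ℝ := deriv step (-ρ x / ε) / ε

theorem layerDensity_nonneg {ε : ℝ} (hε : 0 < ε) (x : E d) : 0 ≤ layerDensity ρ ε x :=
  div_nonneg monotone_step.deriv_nonneg hε.le

theorem cutoff_nonneg (ρ : E d → ℝ) (ε : ℝ) (x : E d) : 0 ≤ cutoff ρ ε x :=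
  Real.smoothTransition.nonneg _

theorem cutoff_le_one (ρ : E d → ℝ) (ε : ℝ) (x : E d) : cutoff ρ ε x ≤ 1 :=
  Real.smoothTransition.le_one _

theorem cutoff_eq_one {ε : ℝ} (hε : 0 < ε) {x : E d} (hx : 2 * ε ≤ -ρ x) : cutoff ρ ε x = 1 :=
  step_eq_one ((le_div_iff₀ hε).2 hx)

theorem cutoff_eq_zero {ε : ℝ} (hε : 0 < ε) {x : E d} (hx : -ρ x < ε) : cutoff ρ ε x = 0 :=
  step_eq_zero ((div_lt_one hε).2 hx).le

theorem layerDensity_eq_zero {ε : ℝ} (hε : 0 < ε) {x : E d} (hx : -ρ x < ε) :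
    layerDensity ρ ε x = 0 := by
  rw [layerDensity, deriv_step_eq_zero_of_lt ((div_lt_one hε).2 hx), zero_div]

theorem layerDensity_eq_zero' {ε : ℝ} (hε : 0 < ε) {x : E d} (hx : 2 * ε < -ρ x) :
    layerDensity ρ ε x = 0 := by
  rw [layerDensity, deriv_step_eq_zero_of_gt ((lt_div_iff₀ hε).2 hx), zero_div]

theorem contDiff_cutoff (hρ : ContDiff ℝ 1 ρ) (ε : ℝ) : ContDiff ℝ 1 (cutoff ρ ε) :=
  (contDiff_step.of_le (by norm_num)).comp (hρ.neg.div_const ε)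

theorem continuous_layerDensity (hρ : ContDiff ℝ 1 ρ) (ε : ℝ) :
    Continuous (layerDensity ρ ε) :=
  ((contDiff_step.continuous_deriv (by norm_num)).comp (hρ.continuous.neg.div_const ε)).div_const ε

theorem gradient_cutoff (hρ : ContDiff ℝ 1 ρ) (ε : ℝ) (x : E d) :
    gradient (cutoff ρ ε) x = -layerDensity ρ ε x • gradient ρ x := by
  refine HasGradientAt.gradient (hasGradientAt_iff_hasFDerivAt.2 ?_)
  have h1 : HasFDerivAt (fun y => -ρ y / ε) (ε⁻¹ • -fderiv ℝ ρ x) x := by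
    simpa [div_eq_inv_mul] using
      ((hρ.differentiable one_ne_zero x).hasFDerivAt.neg.const_mul ε⁻¹)
  have h2 := (contDiff_step.differentiable two_ne_zero (-ρ x / ε)).hasDerivAt.comp_hasFDerivAt x h1
  refine h2.congr_fderiv ?_
  ext v
  simp [layerDensity]
  ring

theorem continuous_gradient (hρ : ContDiff ℝ 1 ρ) : Continuous (gradient ρ) :=
  (InnerProductSpace.toDual ℝ (E d)).symm.continuous.comp (hρ.continuous_fderiv one_ne_zero)

theorem IsGlobalDefining.integrableOn_cutoff_mul (hρ : IsGlobalDefining Ω ρ) (hopen : IsOpen Ω)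
    (hbdd : Bornology.IsBounded Ω) {ε : ℝ} (hε : 0 < ε) {f : E d → ℝ} (hf : ContinuousOn f Ω) :
    IntegrableOn (fun x => cutoff ρ ε x * f x) Ω := by
  refine integrableOn_of_eq_zero_off_compact hopen
    ((contDiff_cutoff hρ.contDiff ε).continuous.continuousOn.mul hf) (hρ.isCompact_inner hbdd ε)
    (hρ.inner_subset hopen hε) fun x hx => ?_
  rw [cutoff_eq_zero hε (not_le.1 fun h => hx.2 ⟨subset_closure hx.1, h⟩), zero_mul]

theorem IsGlobalDefining.integrableOn_layerDensity_mul (hρ : IsGlobalDefining Ω ρ)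
    (hopen : IsOpen Ω) (hbdd : Bornology.IsBounded Ω) {ε : ℝ} (hε : 0 < ε) {f : E d → ℝ}
    (hf : ContinuousOn f Ω) : IntegrableOn (fun x => layerDensity ρ ε x * f x) Ω := by
  refine integrableOn_of_eq_zero_off_compact hopen
    ((continuous_layerDensity hρ.contDiff ε).continuousOn.mul hf) (hρ.isCompact_inner hbdd ε)
    (hρ.inner_subset hopen hε) fun x hx => ?_
  rw [layerDensity_eq_zero hε (not_le.1 fun h => hx.2 ⟨subset_closure hx.1, h⟩), zero_mul]

/-- Integration by parts against the inner cutoff. -/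
theorem IsGlobalDefining.integral_cutoff_mul_div (hρ : IsGlobalDefining Ω ρ) (hopen : IsOpen Ω)
    (hbdd : Bornology.IsBounded Ω) {ε : ℝ} (hε : 0 < ε) {F : E d → E d}
    (hF : ContDiffOn ℝ 1 F Ω) :
    ∫ x in Ω, cutoff ρ ε x * div F x =
      ∫ x in Ω, layerDensity ρ ε x * inner ℝ (gradient ρ x) (F x) := by
  have h0 := setIntegral_div_eq_zero (f := fun x => cutoff ρ ε x • F x) hopen
    ((contDiff_cutoff hρ.contDiff ε).contDiffOn.smul hF) (hρ.isCompact_inner hbdd ε)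
    (hρ.inner_subset hopen hε) fun x hx => by
      rw [cutoff_eq_zero hε (not_le.1 fun h => hx.2 ⟨subset_closure hx.1, h⟩), zero_smul]
  rw [← sub_eq_zero, ← integral_sub (hρ.integrableOn_cutoff_mul hopen hbdd hε
    (continuousOn_div hopen hF)) (hρ.integrableOn_layerDensity_mul hopen hbdd hε
    ((continuous_gradient hρ.contDiff).continuousOn.inner hF.continuousOn)), ← h0]
  refine setIntegral_congr_fun hopen.measurableSet fun x hx => ?_
  rw [div_smul ((contDiff_cutoff hρ.contDiff ε).differentiable one_ne_zero x)
    ((hF.contDiffAt (hopen.mem_nhds hx)).differentiableAt one_ne_zero),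
    gradient_cutoff hρ.contDiff, real_inner_smul_left]
  ring

/-- The boundary layers have uniformly bounded mass. -/
theorem IsGlobalDefining.exists_layerDensity_bound (hρ : IsGlobalDefining Ω ρ) (hopen : IsOpen Ω)
    (hbdd : Bornology.IsBounded Ω) :
    ∃ C : ℝ, 0 < C ∧ ∃ δ > 0, ∀ ε > 0, 2 * ε < δ → ∫ x in Ω, layerDensity ρ ε x ≤ C := by
  obtain ⟨X, hX, hpos⟩ := hρ.exists_transversal
  have hcont : Continuous fun x => inner ℝ (gradient ρ x) (X x) :=
    (continuous_gradient hρ.contDiff).inner hX.continuous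
  have hK : IsCompact (frontier Ω) :=
    hbdd.isCompact_closure.of_isClosed_subset isClosed_frontier frontier_subset_closure
  obtain ⟨c, hc, hcle⟩ : ∃ c > 0, ∀ x ∈ frontier Ω, c ≤ inner ℝ (gradient ρ x) (X x) := by
    rcases (frontier Ω).eq_empty_or_nonempty with he | hne
    · exact ⟨1, one_pos, by simp [he]⟩
    · obtain ⟨z, hz, hmin⟩ := hK.exists_isMinOn hne hcont.continuousOn
      exact ⟨_, hpos z hz, fun x hx => hmin hx⟩
  obtain ⟨δ, hδ, hlayer⟩ := hρ.exists_layer hopen hbdd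
    (p := fun x => c / 2 ≤ inner ℝ (gradient ρ x) (X x)) fun x hx => by
      have : c / 2 < inner ℝ (gradient ρ x) (X x) := by linarith [hcle x hx]
      filter_upwards [nhdsWithin_le_nhds (hcont.continuousAt.eventually (lt_mem_nhds this))]
        with y hy using le_of_lt hy
  have hdiv : Continuous (div X) := continuousOn_univ.1 (continuousOn_div isOpen_univ hX.contDiffOn)
  have hint : IntegrableOn (fun x => |div X x|) Ω :=
    (hdiv.abs.continuousOn.integrableOn_compact hbdd.isCompact_closure).mono_set subset_closure
  -- Integration by parts against the transversal field bounds `c / 2` times the layer mass by the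
  -- integral of `|div X|`, whatever `ε` is. The `+ 1` only makes the constant positive.
  refine ⟨(c / 2)⁻¹ * ((∫ x in Ω, |div X x|) + 1), ?_, δ, hδ, fun ε hε hεδ => ?_⟩
  · have : 0 ≤ ∫ x in Ω, |div X x| := integral_nonneg fun _ => abs_nonneg _
    positivity
  have h1 : ∫ x in Ω, cutoff ρ ε x * div X x ≤ ∫ x in Ω, |div X x| := by
    refine setIntegral_mono_on (hρ.integrableOn_cutoff_mul hopen hbdd hε hdiv.continuousOn) hint
      hopen.measurableSet fun x _ => ?_
    nlinarith [cutoff_nonneg ρ ε x, cutoff_le_one ρ ε x, le_abs_self (div X x),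
      abs_nonneg (div X x)]
  rw [hρ.integral_cutoff_mul_div hopen hbdd hε hX.contDiffOn] at h1
  have h2 : (c / 2) * ∫ x in Ω, layerDensity ρ ε x ≤
      ∫ x in Ω, layerDensity ρ ε x * inner ℝ (gradient ρ x) (X x) := by
    rw [← integral_const_mul]
    refine setIntegral_mono_on ?_ (hρ.integrableOn_layerDensity_mul hopen hbdd hε
      hcont.continuousOn) hopen.measurableSet fun x hx => ?_
    · simpa [mul_comm] using hρ.integrableOn_layerDensity_mul hopen hbdd hε
        (f := fun _ => c / 2) continuousOn_const
    · by_cases hx2 : 2 * ε < -ρ x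
      · simp [layerDensity_eq_zero' hε hx2]
      · rw [mul_comm]
        exact mul_le_mul_of_nonneg_left (hlayer x hx (by linarith)) (layerDensity_nonneg hε x)
  rw [inv_mul_eq_div, le_div_iff₀ (by positivity)]
  linarith

/-- A field with nonnegative divergence in `Ω` and vanishing normal component on the boundary of
`Ω` is divergence free. -/
theorem IsGlobalDefining.div_eq_zero (hρ : IsGlobalDefining Ω ρ) (hopen : IsOpen Ω)
    (hbdd : Bornology.IsBounded Ω) {F : E d → E d} (hF : ContDiffOn ℝ 1 F Ω)
    (hdiv : ∀ x ∈ Ω, 0 ≤ div F x)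
    (hflux : ∀ x ∈ frontier Ω, Tendsto (fun y => inner ℝ (gradient ρ y) (F y)) (𝓝[Ω] x) (𝓝 0)) :
    ∀ x ∈ Ω, div F x = 0 := by
  intro z hz
  by_contra hne
  have hzpos : 0 < div F z := lt_of_le_of_ne (hdiv z hz) (Ne.symm hne)
  have hcont := continuousOn_div hopen hF
  obtain ⟨C, hC, δ, hδ, hbound⟩ := hρ.exists_layerDensity_bound hopen hbdd
  have hev : ∀ᶠ y in 𝓝 z, y ∈ Ω ∧ div F z / 2 < div F y ∧ -ρ z / 2 < -ρ y :=
    (hopen.eventually_mem hz).and (((hcont.continuousAt (hopen.mem_nhds hz)).eventually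
      (lt_mem_nhds (half_lt_self hzpos))).and (hρ.contDiff.continuous.neg.continuousAt.eventually
      (lt_mem_nhds (half_lt_self (neg_pos.2 (hρ.neg z hz))))))
  obtain ⟨r, hr, hball⟩ := Metric.eventually_nhds_iff_ball.1 hev
  have hm : 0 < volume.real (Metric.ball z r) :=
    ENNReal.toReal_pos (Metric.measure_ball_pos volume z hr).ne' measure_ball_lt_top.ne
  -- A lower bound for the integral of `cutoff * div F`, independent of `ε`. The flux threshold `a /
  -- (2 * C)` below is chosen so that the layer integral is at most `a / 2`.
  set a := div F z / 2 * volume.real (Metric.ball z r) with ha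
  have hapos : 0 < a := by positivity
  obtain ⟨δ', hδ', hlayer⟩ := hρ.exists_layer hopen hbdd
    (p := fun x => inner ℝ (gradient ρ x) (F x) ≤ a / (2 * C)) fun x hx => by
      filter_upwards [(hflux x hx).eventually (gt_mem_nhds (show 0 < a / (2 * C) by positivity))]
        with y hy using le_of_lt hy
  have hz0 := neg_pos.2 (hρ.neg z hz)
  obtain ⟨ε, hε, hlt⟩ := exists_between (show 0 < min (-ρ z) (min δ δ') / 4 by positivity)
  -- On the ball `-ρ` exceeds `-ρ z / 2 > 2 * ε`, so the cutoff is identically one there.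
  have hε1 : 4 * ε < -ρ z := by
    linarith [min_le_left (-ρ z) (min δ δ')]
  have hε2 : 2 * ε < δ := by
    linarith [min_le_right (-ρ z) (min δ δ'), min_le_left δ δ']
  have hε3 : 2 * ε < δ' := by
    linarith [min_le_right (-ρ z) (min δ δ'), min_le_right δ δ']
  have hint := hρ.integrableOn_cutoff_mul hopen hbdd hε hcont
  have hlow : a ≤ ∫ x in Ω, cutoff ρ ε x * div F x := by
    calc a = ∫ _ in Metric.ball z r, div F z / 2 := by
          rw [setIntegral_const, smul_eq_mul, mul_comm]
      _ ≤ ∫ x in Metric.ball z r, cutoff ρ ε x * div F x := by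
          refine setIntegral_mono_on (integrableOn_const measure_ball_lt_top.ne)
            (hint.mono_set fun x hx => (hball x hx).1) measurableSet_ball fun x hx => ?_
          rw [cutoff_eq_one hε (by linarith [(hball x hx).2.2]), one_mul]
          exact (hball x hx).2.1.le
      _ ≤ ∫ x in Ω, cutoff ρ ε x * div F x := by
          refine setIntegral_mono_set hint ?_ (LE.le.eventuallyLE fun x hx => (hball x hx).1)
          filter_upwards [ae_restrict_mem hopen.measurableSet] with x hx
          exact mul_nonneg (cutoff_nonneg ρ ε x) (hdiv x hx)
  rw [hρ.integral_cutoff_mul_div hopen hbdd hε hF] at hlow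
  have hupp : ∫ x in Ω, layerDensity ρ ε x * inner ℝ (gradient ρ x) (F x) ≤
      a / (2 * C) * ∫ x in Ω, layerDensity ρ ε x := by
    rw [← integral_const_mul]
    refine setIntegral_mono_on (hρ.integrableOn_layerDensity_mul hopen hbdd hε
      ((continuous_gradient hρ.contDiff).continuousOn.inner hF.continuousOn)) ?_
      hopen.measurableSet fun x hx => ?_
    · simpa [mul_comm] using hρ.integrableOn_layerDensity_mul hopen hbdd hε
        (f := fun _ => a / (2 * C)) continuousOn_const
    · by_cases hx2 : 2 * ε < -ρ x
      · simp [layerDensity_eq_zero' hε hx2]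
      · rw [mul_comm (a / (2 * C))]
        exact mul_le_mul_of_nonneg_left (hlayer x hx (by linarith)) (layerDensity_nonneg hε x)
  have : a / (2 * C) * ∫ x in Ω, layerDensity ρ ε x ≤ a / (2 * C) * C :=
    mul_le_mul_of_nonneg_left (hbound ε hε hε2) (by positivity)
  have h4 : a / (2 * C) * C = a / 2 := by field_simp
  linarith

/-- Uniqueness for the Neumann problem: a harmonic function which is `C¹` up to the boundary, with
vanishing normal derivative, has vanishing gradient. -/
theorem HasC1Boundary.gradient_eq_zero (hC1 : HasC1Boundary Ω) (hopen : IsOpen Ω)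
    (hbdd : Bornology.IsBounded Ω) {w : E d → ℝ} (hw : ContDiffOn ℝ 2 w Ω)
    (hharm : ∀ x ∈ Ω, div (gradient w) x = 0)
    (hbd : ∀ x ∈ frontier Ω, ∃ (c : ℝ) (g : E d), Tendsto w (𝓝[Ω] x) (𝓝 c) ∧
      Tendsto (gradient w) (𝓝[Ω] x) (𝓝 g) ∧ ∀ n, IsOutwardNormal Ω x n → inner ℝ g n = 0) :
    ∀ x ∈ Ω, gradient w x = 0 := by
  obtain ⟨ρ, hρ⟩ := hC1.exists_isGlobalDefining hopen hbdd
  have hg : ContDiffOn ℝ 1 (gradient w) Ω :=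
    (InnerProductSpace.toDual ℝ (E d)).symm.toContinuousLinearEquiv.contDiff.comp_contDiffOn
      (hw.fderiv_of_isOpen hopen (by norm_num))
  have hw1 : ContDiffOn ℝ 1 w Ω := hw.of_le (by norm_num)
  -- The energy identity: the field `w ∇w` has nonnegative divergence, and its flux tends to zero
  -- because `w` has a finite limit at the boundary.
  have hdiv : ∀ x ∈ Ω, div (fun y => w y • gradient w y) x = ‖gradient w x‖ ^ 2 := fun x hx => by
    rw [div_smul ((hw1.contDiffAt (hopen.mem_nhds hx)).differentiableAt one_ne_zero)
      ((hg.contDiffAt (hopen.mem_nhds hx)).differentiableAt one_ne_zero), hharm x hx, mul_zero,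
      zero_add, real_inner_self_eq_norm_sq]
  have hz := hρ.div_eq_zero hopen hbdd (hw1.smul hg)
    (fun x hx => (hdiv x hx).symm ▸ sq_nonneg _) fun x hx => by
      obtain ⟨c, g, hc, hgr, hn⟩ := hbd x hx
      obtain ⟨n, hnx, k, hk, hgk⟩ := hρ.gradient_eq x hx
      have h1 := (((continuous_gradient hρ.contDiff).tendsto x).mono_left
        (nhdsWithin_le_nhds (s := Ω))).inner (𝕜 := ℝ) (hc.smul hgr)
      rwa [hgk, real_inner_smul_left, real_inner_smul_right, real_inner_comm, hn n hnx, mul_zero,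
        mul_zero] at h1
  intro x hx
  have : div (fun y => w y • gradient w y) x = 0 := hz x hx
  rw [hdiv x hx] at this
  simpa using this

end Divergence

/-! ### Matrices acting on Euclidean space -/

section Act

variable {d : ℕ} (M N : Matrix (Fin d) (Fin d) ℝ) (v w : E d)

theorem act_eq_toEuclideanCLM : act M = Matrix.toEuclideanCLM (𝕜 := ℝ) M := by
  funext v
  exact (WithLp.ofLp_injective 2) (Matrix.ofLp_toEuclideanCLM M v).symm

theorem act_add : act M (v + w) = act M v + act M w := by
  rw [act_eq_toEuclideanCLM, map_add]

theorem act_sub : act M (v - w) = act M v - act M w := by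
  rw [act_eq_toEuclideanCLM, map_sub]

theorem act_smul (c : ℝ) : act M (c • v) = c • act M v := by
  rw [act_eq_toEuclideanCLM, map_smul]

theorem act_zero : act M (0 : E d) = 0 := by
  rw [act_eq_toEuclideanCLM, map_zero]

theorem sub_act : act (M - N) v = act M v - act N v := by
  simp only [act_eq_toEuclideanCLM, map_sub]; rfl

theorem smul_act (c : ℝ) : act (c • M) v = c • act M v := by
  simp only [act_eq_toEuclideanCLM, map_smul]; rfl

theorem one_act : act (1 : Matrix (Fin d) (Fin d) ℝ) v = v := by
  simp only [act_eq_toEuclideanCLM, map_one]; rfl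

theorem mul_act : act (M * N) v = act M (act N v) := by
  simp only [act_eq_toEuclideanCLM, map_mul]; rfl

variable {M N}

theorem inner_act_comm (hM : M.IsHermitian) : inner ℝ (act M v) w = inner ℝ v (act M w) := by
  have h : star (Matrix.toEuclideanCLM (𝕜 := ℝ) M) = Matrix.toEuclideanCLM (𝕜 := ℝ) M := by
    rw [← map_star]; exact congrArg _ hM
  rw [act_eq_toEuclideanCLM]
  conv_rhs => rw [← h, ContinuousLinearMap.star_eq_adjoint]
  exact (ContinuousLinearMap.adjoint_inner_right _ _ _).symm

theorem posDef_iff_inner_act :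
    M.PosDef ↔ M.IsHermitian ∧ ∀ x : E d, x ≠ 0 → 0 < inner ℝ x (act M x) := by
  rw [Matrix.posDef_iff_dotProduct_mulVec]
  refine and_congr_right fun _ => ⟨fun h x hx => ?_, fun h x hx => ?_⟩
  · have := h (x := x.ofLp) (fun h0 => hx (WithLp.ofLp_injective 2 h0))
    rw [EuclideanSpace.inner_eq_star_dotProduct, dotProduct_comm]
    exact this
  · have := h (WithLp.toLp 2 x) (fun h0 => hx (WithLp.toLp_injective 2 h0))
    rw [EuclideanSpace.inner_eq_star_dotProduct, dotProduct_comm] at this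
    exact this

theorem _root_.Matrix.PosDef.inner_act_pos (hM : M.PosDef) {x : E d} (hx : x ≠ 0) :
    0 < inner ℝ x (act M x) :=
  (posDef_iff_inner_act.1 hM).2 x hx

theorem _root_.Matrix.PosDef.act_inv_act (hM : M.PosDef) : act M⁻¹ (act M v) = v := by
  rw [← mul_act, Matrix.nonsing_inv_mul _ ((Matrix.isUnit_iff_isUnit_det _).1 hM.isUnit), one_act]

theorem _root_.Matrix.PosDef.act_act_inv (hM : M.PosDef) : act M (act M⁻¹ v) = v := by
  rw [← mul_act, Matrix.mul_nonsing_inv _ ((Matrix.isUnit_iff_isUnit_det _).1 hM.isUnit), one_act]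

end Act

/-! ### Domains whose normal is transversal to the rays from a point -/

section Geometry

variable {d : ℕ} {Ω : Set (E d)} {x₀ : E d}

theorem eventually_add_smul_mem (hopen : IsOpen Ω) {x : E d} (hx : x ∈ Ω) (v : E d) :
    ∀ᶠ t in 𝓝[>] (0 : ℝ), x + t • v ∈ Ω :=
  (tendsto_add_smul_nhdsGT x v).eventually (hopen.eventually_mem hx)

/-- The origin of a transversal radial field lies in the domain. -/
theorem center_mem (hopen : IsOpen Ω) (hbdd : Bornology.IsBounded Ω) (hne : Ω.Nonempty)
    (h : ∀ x ∈ frontier Ω, ∃ n, IsOutwardNormal Ω x n ∧ 0 < inner ℝ n (x - x₀)) : x₀ ∈ Ω := by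
  -- From a closest point of the closure one can move towards `x₀` within `Ω`, so the distance is
  -- zero. The point `x₀` is not on the frontier, where `0 < inner ℝ n 0` would be required.
  obtain ⟨x, hx, hmin⟩ := hbdd.isCompact_closure.exists_isMinOn hne.closure
    (f := fun y => dist y x₀) (by fun_prop)
  have hev : ∀ᶠ t in 𝓝[>] (0 : ℝ), x + t • (x₀ - x) ∈ Ω := by
    by_cases hf : x ∈ frontier Ω
    · obtain ⟨n, hn, hpos⟩ := h x hf
      refine hn.eventually_mem hopen hf ?_
      rw [← neg_sub, inner_neg_right]
      linarith
    · exact eventually_add_smul_mem hopen (mem_of_mem_closure_of_notMem_frontier hopen hx hf) _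
  obtain ⟨t, ht, ht0, ht1⟩ := (hev.and (Ioo_mem_nhdsGT one_pos)).exists
  have hle : dist x x₀ ≤ dist (x + t • (x₀ - x)) x₀ := hmin (subset_closure ht)
  have heq : x + t • (x₀ - x) - x₀ = (1 - t) • (x - x₀) := by module
  rw [dist_eq_norm, dist_eq_norm, heq, norm_smul, Real.norm_of_nonneg (by linarith)] at hle
  have h0 : ‖x - x₀‖ = 0 := le_antisymm (by nlinarith) (norm_nonneg _)
  have hxx : x = x₀ := sub_eq_zero.1 (norm_eq_zero.1 h0)
  subst hxx
  refine mem_of_mem_closure_of_notMem_frontier hopen hx fun hf => ?_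
  obtain ⟨n, -, hpos⟩ := h x hf
  simp at hpos

theorem frontier_nonempty [Nontrivial (E d)] (hbdd : Bornology.IsBounded Ω) (hne : Ω.Nonempty) :
    (frontier Ω).Nonempty := by
  have : NoncompactSpace (E d) := NormedSpace.noncompactSpace ℝ (E d)
  refine nonempty_frontier_iff.2 ⟨hne, ?_⟩
  rintro rfl
  exact NoncompactSpace.noncompact_univ (X := E d) (by simpa using hbdd.isCompact_closure)

/-- The outward normal of a bounded domain cannot point towards a fixed point everywhere. -/
theorem not_forall_inner_neg [Nontrivial (E d)] (hopen : IsOpen Ω) (hbdd : Bornology.IsBounded Ω)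
    (hne : Ω.Nonempty)
    (h : ∀ x ∈ frontier Ω, ∃ n, IsOutwardNormal Ω x n ∧ inner ℝ n (x - x₀) < 0) : False := by
  -- From a farthest point one could still move away from `x₀` within `Ω`. So the closure collapses
  -- to `x₀`, and at a frontier point the strict inequality reads `0 < 0`.
  obtain ⟨x, hx, hmax⟩ := hbdd.isCompact_closure.exists_isMaxOn hne.closure
    (f := fun y => dist y x₀) (by fun_prop)
  have hev : ∀ᶠ t in 𝓝[>] (0 : ℝ), x + t • (x - x₀) ∈ Ω := by
    by_cases hf : x ∈ frontier Ω
    · obtain ⟨n, hn, hneg⟩ := h x hf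
      exact hn.eventually_mem hopen hf hneg
    · exact eventually_add_smul_mem hopen (mem_of_mem_closure_of_notMem_frontier hopen hx hf) _
  obtain ⟨t, ht, ht0⟩ := (hev.and self_mem_nhdsWithin).exists
  have ht0 : 0 < t := ht0
  have hle : dist (x + t • (x - x₀)) x₀ ≤ dist x x₀ := hmax (subset_closure ht)
  have heq : x + t • (x - x₀) - x₀ = (1 + t) • (x - x₀) := by module
  rw [dist_eq_norm, dist_eq_norm, heq, norm_smul, Real.norm_of_nonneg (by linarith)] at hle
  have h0 : ‖x - x₀‖ = 0 := le_antisymm (by nlinarith) (norm_nonneg _)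
  obtain ⟨z, hz⟩ := frontier_nonempty hbdd hne
  obtain ⟨n, -, hneg⟩ := h z hz
  have hzle : dist z x₀ ≤ dist x x₀ := hmax (frontier_subset_closure hz)
  rw [dist_eq_norm, dist_eq_norm, h0] at hzle
  have : z - x₀ = 0 := norm_eq_zero.1 (le_antisymm hzle (norm_nonneg _))
  simp [this] at hneg

/-- If the outward normal points away from `x₀` then `Ω` is star-shaped about `x₀`, and each ray
from `x₀` leaves `Ω` at a single point. -/
theorem exists_gauge (hopen : IsOpen Ω) (hbdd : Bornology.IsBounded Ω) (hx₀ : x₀ ∈ Ω)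
    (h : ∀ x ∈ frontier Ω, ∃ n, IsOutwardNormal Ω x n ∧ 0 < inner ℝ n (x - x₀))
    {v : E d} (hv : v ≠ 0) :
    ∃ g : ℝ, 0 < g ∧ x₀ + g⁻¹ • v ∈ frontier Ω ∧ ∀ r : ℝ, 0 < r → (x₀ + r⁻¹ • v ∈ Ω ↔ g < r) := by
  have hline : Continuous fun t : ℝ => x₀ + t • v := by fun_prop
  set T : Set ℝ := {t | 0 ≤ t ∧ x₀ + t • v ∉ Ω} with hT
  have hTc : IsClosed T :=
    isClosed_Ici.inter (hopen.isClosed_compl.preimage hline)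
  have hTne : T.Nonempty := by
    obtain ⟨r, hr, hΩ⟩ := hbdd.subset_ball_lt 0 x₀
    refine ⟨r / ‖v‖, by positivity, fun hmem => ?_⟩
    have := hΩ hmem
    rw [Metric.mem_ball, dist_eq_norm, add_sub_cancel_left, norm_smul,
      Real.norm_of_nonneg (by positivity), div_mul_cancel₀ _ (norm_ne_zero_iff.2 hv)] at this
    exact lt_irrefl _ this
  have hTb : BddBelow T := ⟨0, fun t ht => ht.1⟩
  set R := sInf T with hR
  have hRT : R ∈ T := hTc.csInf_mem hTne hTb
  have hR0 : 0 < R := lt_of_le_of_ne hRT.1 fun h0 => hRT.2 (by rw [← h0]; simpa using hx₀)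
  have hlt : ∀ t, 0 ≤ t → t < R → x₀ + t • v ∈ Ω := fun t ht htR => by
    by_contra hmem
    exact notMem_of_lt_csInf htR hTb ⟨ht, hmem⟩
  have hge : ∀ t, R < t → x₀ + t • v ∉ Ω := by
    intro t htR hmem
    have hS : IsCompact (Icc R t ∩ {s | x₀ + s • v ∈ Ωᶜ}) :=
      isCompact_Icc.inter_right (hopen.isClosed_compl.preimage hline)
    -- If the ray returned to `Ω` at time `t`, the last earlier time `s` outside `Ω` would be an
    -- entry point, while the normal there sends the ray into the exterior.
    obtain ⟨s, ⟨⟨hRs, hst⟩, hsΩ⟩, hmax⟩ := hS.exists_isMaxOn ⟨R, ⟨le_rfl, htR.le⟩, hRT.2⟩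
      continuousOn_id
    have hst' : s < t := lt_of_le_of_ne hst fun he => hsΩ (he ▸ hmem)
    have hin : ∀ r, s < r → r ≤ t → x₀ + r • v ∈ Ω := fun r hsr hrt => by
      by_contra hr
      exact absurd (hmax (⟨⟨hRs.trans hsr.le, hrt⟩, hr⟩ : r ∈ Icc R t ∩ {s | x₀ + s • v ∈ Ωᶜ}))
        (not_le.2 hsr)
    have hsf : x₀ + s • v ∈ frontier Ω := by
      rw [hopen.frontier_eq]
      refine ⟨map_mem_closure hline (s := Ioc s t) (by simp [closure_Ioc hst'.ne, hst])
        fun r hr => hin r hr.1 hr.2, hsΩ⟩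
    obtain ⟨n, hn, hpos⟩ := h _ hsf
    rw [add_sub_cancel_left, real_inner_smul_right] at hpos
    have hpos' : 0 < inner ℝ n v := pos_of_mul_pos_right hpos (hR0.le.trans hRs)
    obtain ⟨r, hr, hr0, hrt⟩ := ((hn.eventually_mem_ext hopen hsf hpos').and
      (Ioo_mem_nhdsGT (sub_pos.2 hst'))).exists
    refine disjoint_left.1 (disjoint_ext Ω) (hin (s + r) (by linarith) (by linarith)) ?_
    rwa [add_smul, ← add_assoc]
  refine ⟨R⁻¹, inv_pos.2 hR0, ?_, fun r hr => ?_⟩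
  · rw [inv_inv, hopen.frontier_eq]
    exact ⟨map_mem_closure hline (s := Ico 0 R) (by simp [closure_Ico hR0.ne, hR0.le])
      fun r hr => hlt r hr.1 hr.2, hRT.2⟩
  · rw [inv_lt_comm₀ hR0 hr]
    refine ⟨fun hmem => ?_, fun hlt' => hlt _ (inv_pos.2 hr).le hlt'⟩
    rcases lt_trichotomy r⁻¹ R with h1 | h1 | h1
    · exact h1
    · exact absurd hmem (h1 ▸ hRT.2)
    · exact absurd hmem (hge _ h1)

end Geometry

/-! ### The gauge of the domain and its identification with a quadratic form -/

section Ellipsoid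

variable {d : ℕ} {Ω : Set (E d)} {x₀ : E d} {A : Matrix (Fin d) (Fin d) ℝ}

/-- The level sets of `g` are dilates of the boundary, so its gradient is parallel to `A v`, and
Euler's identity for degree one fixes the factor. The proof is by squeezing: changing the candidate
linearization by `± ε ‖w‖` puts the corresponding point on the ray through `v + w` inside `Ω`,
respectively in the exterior, which traps `g (v + w)`. -/
theorem hasFDerivAt_gauge (hopen : IsOpen Ω) (hA : A.PosDef)
    (h : ∀ x ∈ frontier Ω, ∃ n, IsOutwardNormal Ω x n ∧ ∃ b : ℝ, 0 < b ∧ n = b • act A (x - x₀))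
    {g : E d → ℝ} (hg : ∀ v ≠ 0, 0 < g v ∧ x₀ + (g v)⁻¹ • v ∈ frontier Ω ∧
      ∀ r : ℝ, 0 < r → (x₀ + r⁻¹ • v ∈ Ω ↔ g v < r)) {v : E d} (hv : v ≠ 0) :
    HasFDerivAt g ((g v / inner ℝ v (act A v)) • innerSL ℝ (act A v)) v := by
  obtain ⟨hg0, hgf, -⟩ := hg v hv
  have hq : 0 < inner ℝ v (act A v) := hA.inner_act_pos hv
  set q := inner ℝ v (act A v) with hqdef
  set G := g v with hG
  obtain ⟨n, hn, b, hb, hnb⟩ := h _ hgf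
  rw [add_sub_cancel_left, act_smul, smul_smul] at hnb
  rw [hasFDerivAt_iff_isLittleO_nhds_zero, isLittleO_iff]
  intro ε hε
  set C := G + (‖act A v‖ * G / q + ε) * ‖v‖ with hC
  have hC0 : 0 < C := by positivity
  -- the competitor points on the ray through `v + w`
  have key : ∀ s : ℝ, |s| = ε → ∀ᶠ w in 𝓝 (0 : E d), w ≠ 0 →
      0 < G + inner ℝ (act A v) w * G / q + s * ‖w‖ ∧
      (0 < s → x₀ + (G + inner ℝ (act A v) w * G / q + s * ‖w‖)⁻¹ • (v + w) ∈ Ω) ∧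
      (s < 0 → x₀ + (G + inner ℝ (act A v) w * G / q + s * ‖w‖)⁻¹ • (v + w) ∈ ext Ω) := by
    intro s hs
    set L : E d → ℝ := fun w => G + inner ℝ (act A v) w * G / q + s * ‖w‖ with hL
    have hLc : Continuous L := by fun_prop
    have hL0 : L 0 = G := by simp [hL]
    have hyc : ContinuousAt (fun w => x₀ + (L w)⁻¹ • (v + w)) 0 := by
      refine continuousAt_const.add ((hLc.continuousAt.inv₀ ?_).smul (by fun_prop))
      rw [hL0]; exact hg0.ne'
    have hyt : Tendsto (fun w => x₀ + (L w)⁻¹ • (v + w)) (𝓝 0) (𝓝 (x₀ + G⁻¹ • v)) := by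
      have := hyc.tendsto
      rwa [hL0, add_zero] at this
    -- Half the ratio of the normal displacement (`hinner`) to the bound on the total displacement
    -- (`hnorm`), so that the cone condition holds strictly.
    have hκ : 0 < b * G⁻¹ * q * ε / (2 * C) := by positivity
    filter_upwards [hyt.eventually (hn.eventually_cone hopen hgf hκ),
      hLc.continuousAt.eventually (lt_mem_nhds (show 0 < L 0 by rw [hL0]; exact hg0))]
      with w hw hLw hw0
    have hw0' : 0 < ‖w‖ := norm_pos_iff.2 hw0
    have hdiff : x₀ + (L w)⁻¹ • (v + w) - (x₀ + G⁻¹ • v) =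
        (L w * G)⁻¹ • (G • w - (L w - G) • v) := by
      have h1 : (L w)⁻¹ = (L w * G)⁻¹ * G := by field_simp
      have h2 : G⁻¹ = (L w * G)⁻¹ * L w := by field_simp
      rw [h1, h2]
      module
    have hLG : L w - G = inner ℝ (act A v) w * G / q + s * ‖w‖ := by simp only [hL]; ring
    -- The linear term of `L` is exactly the one that cancels the normal component of `w`; only the
    -- correction `s * ‖w‖` remains.
    have hinner : inner ℝ n (x₀ + (L w)⁻¹ • (v + w) - (x₀ + G⁻¹ • v)) =
        -((L w * G)⁻¹ * (b * G⁻¹ * q * (s * ‖w‖))) := by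
      rw [hdiff, hnb, real_inner_smul_left, real_inner_smul_right, inner_sub_right,
        real_inner_smul_right, real_inner_smul_right, hLG, real_inner_comm v, ← hqdef]
      field_simp
      ring
    have habs : |inner ℝ (act A v) w| ≤ ‖act A v‖ * ‖w‖ := abs_real_inner_le_norm _ _
    have hnorm : ‖x₀ + (L w)⁻¹ • (v + w) - (x₀ + G⁻¹ • v)‖ ≤ (L w * G)⁻¹ * (C * ‖w‖) := by
      rw [hdiff, norm_smul, Real.norm_of_nonneg (by positivity)]
      refine mul_le_mul_of_nonneg_left ?_ (by positivity)
      have h1 : |L w - G| ≤ (‖act A v‖ * G / q + ε) * ‖w‖ := by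
        rw [hLG]
        refine (abs_add_le _ _).trans ?_
        rw [abs_div, abs_mul, abs_mul, hs, abs_of_pos hg0, abs_of_pos hq, abs_norm, add_mul]
        gcongr
        rw [div_mul_eq_mul_div, mul_right_comm]
        gcongr
      calc ‖G • w - (L w - G) • v‖ ≤ ‖G • w‖ + ‖(L w - G) • v‖ := norm_sub_le _ _
        _ = G * ‖w‖ + |L w - G| * ‖v‖ := by
          rw [norm_smul, norm_smul, Real.norm_of_nonneg hg0.le, Real.norm_eq_abs]
        _ ≤ G * ‖w‖ + (‖act A v‖ * G / q + ε) * ‖w‖ * ‖v‖ := by gcongr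
        _ = C * ‖w‖ := by rw [hC]; ring
    have hcone : b * G⁻¹ * q * ε / (2 * C) * ‖x₀ + (L w)⁻¹ • (v + w) - (x₀ + G⁻¹ • v)‖ <
        (L w * G)⁻¹ * (b * G⁻¹ * q * (ε * ‖w‖)) := by
      calc _ ≤ b * G⁻¹ * q * ε / (2 * C) * ((L w * G)⁻¹ * (C * ‖w‖)) := by gcongr
        _ = (L w * G)⁻¹ * (b * G⁻¹ * q * (ε * ‖w‖)) / 2 := by field_simp
        _ < _ := half_lt_self (by positivity)
    rw [hinner] at hw
    refine ⟨hLw, fun hs0 => hw.1 ?_, fun hs0 => hw.2 ?_⟩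
    · rw [abs_of_pos hs0] at hs
      rw [hs]
      exact neg_lt_neg hcone
    · rw [abs_of_neg hs0] at hs
      refine hcone.trans_eq ?_
      rw [← hs]
      ring
  have hne : ∀ᶠ w in 𝓝 (0 : E d), v + w ≠ 0 := by
    have hc : ContinuousAt (fun w => v + w) (0 : E d) := by fun_prop
    exact hc.eventually_ne (by simpa using hv)
  filter_upwards [key ε (abs_of_pos hε), key (-ε) (by rw [abs_neg, abs_of_pos hε]), hne]
    with w h1 h2 hvw
  rcases eq_or_ne w 0 with rfl | hw0
  · simp [hG]
  obtain ⟨hL1, hin, -⟩ := h1 hw0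
  obtain ⟨hL2, -, hout⟩ := h2 hw0
  have hup := ((hg _ hvw).2.2 _ hL1).1 (hin hε)
  have hlow : G + inner ℝ (act A v) w * G / q + -ε * ‖w‖ ≤ g (v + w) := by
    by_contra! hlt
    exact disjoint_left.1 (disjoint_ext Ω) (((hg _ hvw).2.2 _ hL2).2 hlt)
      (hout (by linarith))
  have hderiv : ((G / q) • innerSL ℝ (act A v)) w = inner ℝ (act A v) w * G / q := by
    simp only [smul_apply, innerSL_apply_apply, smul_eq_mul]
    ring
  rw [hderiv, Real.norm_eq_abs, abs_le]
  constructor <;> linarith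

theorem hasFDerivAt_inner_act (hA : A.IsHermitian) (v : E d) :
    HasFDerivAt (fun v => inner ℝ v (act A v)) ((2 : ℝ) • innerSL ℝ (act A v)) v := by
  have h1 : HasFDerivAt (act A) (Matrix.toEuclideanCLM (𝕜 := ℝ) A) v := by
    rw [act_eq_toEuclideanCLM]
    exact (Matrix.toEuclideanCLM (𝕜 := ℝ) A).hasFDerivAt
  refine ((hasFDerivAt_id v).inner ℝ h1).congr_fderiv ?_
  ext w
  have h2 : inner ℝ v (act A w) = inner ℝ (act A v) w := (inner_act_comm v w hA).symm
  rw [act_eq_toEuclideanCLM] at h2 ⊢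
  simp [h2, real_inner_comm]
  ring

/-- A bounded domain whose outward normal is a positive multiple of `A (x - x₀)` is a sublevel set
of the quadratic form of `A`. -/
theorem eq_ellipsoid (hd : 2 ≤ d) (hopen : IsOpen Ω) (hbdd : Bornology.IsBounded Ω)
    (hne : Ω.Nonempty) (hA : A.PosDef)
    (h : ∀ x ∈ frontier Ω, ∃ n, IsOutwardNormal Ω x n ∧
      ∃ b : ℝ, 0 < b ∧ n = b • act A (x - x₀)) :
    ∃ t : ℝ, 0 < t ∧ Ω = ellipsoid x₀ (t • A) := by
  have hpos : ∀ x ∈ frontier Ω, ∃ n, IsOutwardNormal Ω x n ∧ 0 < inner ℝ n (x - x₀) := by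
    intro x hx
    obtain ⟨n, hn, b, hb, hnb⟩ := h x hx
    refine ⟨n, hn, ?_⟩
    have hx0 : x - x₀ ≠ 0 := fun h0 => hn.ne_zero (by rw [hnb, h0, act_zero, smul_zero])
    rw [hnb, real_inner_smul_left, real_inner_comm]
    exact mul_pos hb (hA.inner_act_pos hx0)
  have hx₀ := center_mem hopen hbdd hne hpos
  have hgauge : ∀ v : E d, ∃ g : ℝ, v ≠ 0 → 0 < g ∧ x₀ + g⁻¹ • v ∈ frontier Ω ∧
      ∀ r : ℝ, 0 < r → (x₀ + r⁻¹ • v ∈ Ω ↔ g < r) := fun v => by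
    by_cases hv : v = 0
    · exact ⟨0, fun h => absurd hv h⟩
    · obtain ⟨g, hg⟩ := exists_gauge hopen hbdd hx₀ hpos hv
      exact ⟨g, fun _ => hg⟩
  choose g hg using hgauge
  -- With `q = v·Av`, both `g²` and `q` have logarithmic derivative `2 (Av·) / q`, so the quotient
  -- is stationary.
  have hderiv : ∀ v ≠ 0, HasFDerivAt (fun v => g v ^ 2 * (inner ℝ v (act A v))⁻¹)
      (0 : E d →L[ℝ] ℝ) v := by
    intro v hv
    have hq := hA.inner_act_pos hv
    have h1 := (hasFDerivAt_gauge hopen hA h hg hv).pow 2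
    have h2 := (hasDerivAt_inv hq.ne').comp_hasFDerivAt v (hasFDerivAt_inner_act hA.1 v)
    refine (h1.mul h2).congr_fderiv ?_
    ext w
    simp
    field_simp
    ring
  -- Here `d ≥ 2` matters: on a line the two half-lines could carry different constants.
  have hconn : IsConnected ({0}ᶜ : Set (E d)) := by
    refine isConnected_compl_singleton_of_one_lt_rank ?_ 0
    rw [← Module.finrank_eq_rank, finrank_euclideanSpace_fin]
    exact_mod_cast hd
  obtain ⟨K, hK⟩ := isOpen_compl_singleton.exists_is_const_of_fderiv_eq_zero (𝕜 := ℝ)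
    hconn.isPreconnected
    (fun v hv => (hderiv v hv).differentiableAt.differentiableWithinAt)
    (fun v hv => (hderiv v hv).fderiv)
  have hKq : ∀ v : E d, v ≠ 0 → K * inner ℝ v (act A v) = g v ^ 2 := fun v hv => by
    rw [← hK v hv, inv_mul_cancel_right₀ (hA.inner_act_pos hv).ne']
  refine ⟨K, ?_, ?_⟩
  · obtain ⟨v, hv⟩ := hconn.nonempty
    have := hA.inner_act_pos hv
    have := (hg v hv).1
    rw [← hK v hv]
    positivity
  · ext y
    simp only [ellipsoid, mem_ofPred_eq, smul_act, real_inner_smul_right]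
    by_cases hy : y - x₀ = 0
    · rw [sub_eq_zero.1 hy]
      simp [hx₀]
    · have h1 := (hg _ hy).2.2 1 one_pos
      rw [inv_one, one_smul, add_sub_cancel] at h1
      rw [h1, hKq _ hy, sq_lt_one_iff₀ (hg _ hy).1.le]

end Ellipsoid

/-! ### Strict antitonicity of inversion against a multiple of the identity -/

section InverseOrder

variable {d : ℕ} {M : Matrix (Fin d) (Fin d) ℝ} {c : ℝ}

/-- With `y = M⁻¹ x`, expand the `M`-square of `y - c⁻¹ x`, which is nonnegative, and use `x·Mx < c
|x|²`. -/
theorem posDef_inv_sub (hc : 0 < c) (hM : M.PosDef)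
    (h : (c • (1 : Matrix (Fin d) (Fin d) ℝ) - M).PosDef) :
    (M⁻¹ - c⁻¹ • (1 : Matrix (Fin d) (Fin d) ℝ)).PosDef := by
  refine posDef_iff_inner_act.2
    ⟨hM.inv.1.sub (Matrix.PosDef.one.smul (inv_pos.2 hc)).1, fun x hx => ?_⟩
  have h1 := h.inner_act_pos hx
  have hy := hM.act_act_inv x
  set y := act M⁻¹ x
  have h2 : 0 ≤ inner ℝ (y - c⁻¹ • x) (act M (y - c⁻¹ • x)) := by
    by_cases h0 : y - c⁻¹ • x = 0
    · simp [h0]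
    · exact (hM.inner_act_pos h0).le
  have h3 : inner ℝ y (act M x) = inner ℝ x x := by
    rw [← inner_act_comm _ _ hM.1, hy]
  rw [act_sub, act_smul, hy, inner_sub_left, inner_sub_right, inner_sub_right,
    real_inner_smul_left, real_inner_smul_left, real_inner_smul_right, real_inner_smul_right, h3,
    real_inner_comm x y] at h2
  rw [sub_act, smul_act, one_act, inner_sub_right, real_inner_smul_right] at h1
  rw [sub_act, smul_act, one_act, inner_sub_right, real_inner_smul_right]
  have h4 : c⁻¹ * (c⁻¹ * inner ℝ x (act M x)) < c⁻¹ * (c⁻¹ * (c * inner ℝ x x)) := by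
    have := inv_pos.2 hc
    gcongr
    linarith
  rw [inv_mul_cancel_left₀ hc.ne'] at h4
  linarith

/-- With `y = M⁻¹ x`, expand `|x - c y|² ≥ 0` and use `y·x = y·My > c |y|²`. -/
theorem posDef_sub_inv (hc : 0 < c) (hM : M.PosDef)
    (h : (M - c • (1 : Matrix (Fin d) (Fin d) ℝ)).PosDef) :
    (c⁻¹ • (1 : Matrix (Fin d) (Fin d) ℝ) - M⁻¹).PosDef := by
  refine posDef_iff_inner_act.2
    ⟨(Matrix.PosDef.one.smul (inv_pos.2 hc)).1.sub hM.inv.1, fun x hx => ?_⟩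
  have hy := hM.act_act_inv x
  set y := act M⁻¹ x
  have hy0 : y ≠ 0 := fun h0 => hx (by rw [← hy, h0, act_zero])
  have h1 := h.inner_act_pos hy0
  have h2 : 0 ≤ inner ℝ (x - c • y) (x - c • y) := real_inner_self_nonneg
  rw [inner_sub_left, inner_sub_right, inner_sub_right, real_inner_smul_left, real_inner_smul_left,
    real_inner_smul_right, real_inner_smul_right, real_inner_comm x y] at h2
  rw [sub_act, smul_act, one_act, hy, inner_sub_right, real_inner_smul_right,
    real_inner_comm x y] at h1
  rw [sub_act, smul_act, one_act, inner_sub_right, real_inner_smul_right, sub_pos,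
    inv_mul_eq_div, lt_div_iff₀ hc]
  nlinarith

end InverseOrder

/-! ### From neutrality to the shape of the normal -/

section Neutral

variable {d : ℕ} {Ω : Set (E d)} {σc : ℝ} {σm : Matrix (Fin d) (Fin d) ℝ} {β : E d → ℝ}

theorem hasGradientAt_inner_add (p : E d) (c : ℝ) (x : E d) :
    HasGradientAt (fun y => inner ℝ p y + c) p x := by
  rw [hasGradientAt_iff_hasFDerivAt]
  exact ((innerSL ℝ p).hasFDerivAt (x := x)).add_const c

theorem div_const (v : E d) (x : E d) : div (fun _ => v) x = 0 := by
  simp [div]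

theorem isOpen_ext (Ω : Set (E d)) : IsOpen (ext Ω) := isClosed_closure.isOpen_compl

/-- If the field outside `Ω` is not perturbed then the solution is affine in `Ω`. -/
theorem IsLCSolution.eq_affine (hopen : IsOpen Ω) (hbdd : Bornology.IsBounded Ω)
    (hconn : IsPreconnected Ω) (hC1 : HasC1Boundary Ω) (hσc : 0 < σc) {a : E d} {u : E d → ℝ}
    (hu : IsLCSolution Ω σc σm β a u) (hout : ∀ x ∈ Ωᶜ, u x = inner ℝ a x) :
    ∃ c : ℝ, ∀ x ∈ frontier Ω, ∀ n, IsOutwardNormal Ω x n →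
      β x * (inner ℝ a x - (σc⁻¹ * inner ℝ (act σm a) x + c)) = inner ℝ (act σm a) n := by
  have hext : ∀ x ∈ ext Ω, u x = inner ℝ a x := fun x hx =>
    hout x fun h => hx (subset_closure h)
  have hgext : ∀ x ∈ ext Ω, gradient u x = a := fun x hx => by
    refine HasGradientAt.gradient ((hasGradientAt_inner_add a 0 x).congr_of_eventuallyEq ?_)
    filter_upwards [(isOpen_ext Ω).mem_nhds hx] with y hy
    rw [hext y hy, add_zero]
  -- The only possible interior gradient: its flux `σc p·n` equals the exterior flux `σm a·n`.
  set p := σc⁻¹ • act σm a with hp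
  have hcd : ContDiffOn ℝ 2 u Ω := hu.contDiffOn.mono subset_union_left
  have hlin : ContDiff ℝ 2 fun x => inner ℝ p x := (innerSL ℝ p).contDiff
  set w : E d → ℝ := fun x => u x - inner ℝ p x with hw
  have hdiff : ∀ x ∈ Ω, DifferentiableAt ℝ u x := fun x hx =>
    (hcd.contDiffAt (hopen.mem_nhds hx)).differentiableAt two_ne_zero
  have hgw : ∀ x ∈ Ω, gradient w x = gradient u x - p := fun x hx => by
    refine HasGradientAt.gradient ?_
    rw [hasGradientAt_iff_hasFDerivAt, map_sub]
    refine (hdiff x hx).hasGradientAt.hasFDerivAt.sub ?_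
    exact (innerSL ℝ p).hasFDerivAt
  have hgcd : ContDiffOn ℝ 1 (gradient u) Ω :=
    (InnerProductSpace.toDual ℝ (E d)).symm.toContinuousLinearEquiv.contDiff.comp_contDiffOn
      (hcd.fderiv_of_isOpen hopen (by norm_num))
  have hharm : ∀ x ∈ Ω, div (gradient w) x = 0 := by
    intro x hx
    have hgd : DifferentiableAt ℝ (gradient u) x :=
      (hgcd.contDiffAt (hopen.mem_nhds hx)).differentiableAt one_ne_zero
    have h1 : div (gradient w) x = div (gradient u) x := by
      have he : gradient w =ᶠ[𝓝 x] fun y => gradient u y - p := by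
        filter_upwards [hopen.mem_nhds hx] with y hy using hgw y hy
      rw [div_congr he]
      unfold div
      rw [fderiv_sub_const]
    have h2 := hu.equation x (Or.inl hx)
    have h3 : (fun y => act (conductivity Ω σc σm y) (gradient u y)) =ᶠ[𝓝 x]
        fun y => σc • gradient u y := by
      filter_upwards [hopen.mem_nhds hx] with y hy
      rw [conductivity, if_pos hy, smul_act, one_act]
    rw [div_congr h3, div_smul (differentiableAt_const σc) hgd, gradient_fun_const,
      inner_zero_left, add_zero] at h2
    rw [h1]
    exact (mul_eq_zero.1 h2).resolve_left hσc.ne'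
  have hgrad := hC1.gradient_eq_zero hopen hbdd (hcd.sub hlin.contDiffOn) hharm fun x hx => by
    obtain ⟨um, up, gm, gp, hum, hup, hgm, hgp, hn⟩ := hu.interface x hx
    refine ⟨um - inner ℝ p x, gm - p, ?_, ?_, fun n hnx => ?_⟩
    · exact hum.sub ((hlin.continuous.tendsto x).mono_left nhdsWithin_le_nhds)
    · refine (hgm.sub_const p).congr' ?_
      filter_upwards [self_mem_nhdsWithin] with y hy using (hgw y hy).symm
    · have := hnx.nhdsWithin_ext_neBot hopen hx
      have hga : gp = a := by
        refine tendsto_nhds_unique hgp (tendsto_const_nhds.congr' ?_)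
        filter_upwards [self_mem_nhdsWithin] with y hy using (hgext y hy).symm
      have h1 := (hn n hnx).2
      rw [hga] at h1
      rw [inner_sub_left, hp, real_inner_smul_left, ← h1, inv_mul_cancel_left₀ hσc.ne', sub_self]
  obtain ⟨c, hc⟩ := hopen.exists_is_const_of_fderiv_eq_zero (𝕜 := ℝ) hconn
    (f := w) (fun x hx => ((hdiff x hx).sub
      (hlin.differentiable two_ne_zero x)).differentiableWithinAt) (fun x hx => by
      have h := toDual_gradient (𝕜 := ℝ) (f := w) (x := x)
      rw [hgrad x hx, map_zero] at h
      exact h.symm)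
  refine ⟨c, fun x hx n hnx => ?_⟩
  obtain ⟨um, up, gm, gp, hum, hup, hgm, hgp, hn⟩ := hu.interface x hx
  have := hnx.nhdsWithin_ext_neBot hopen hx
  have := nhdsWithin_neBot hx
  have hga : gp = a := by
    refine tendsto_nhds_unique hgp (tendsto_const_nhds.congr' ?_)
    filter_upwards [self_mem_nhdsWithin] with y hy using (hgext y hy).symm
  have hupa : up = inner ℝ a x := by
    have hca : Continuous fun y : E d => inner ℝ a y := by fun_prop
    refine tendsto_nhds_unique hup (((hca.tendsto x).mono_left nhdsWithin_le_nhds).congr' ?_)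
    filter_upwards [self_mem_nhdsWithin] with y hy using (hext y hy).symm
  have huma : um = inner ℝ p x + c := by
    refine tendsto_nhds_unique hum (((hlin.continuous.add_const c).tendsto x |>.mono_left
      nhdsWithin_le_nhds).congr' ?_)
    filter_upwards [self_mem_nhdsWithin] with y hy
    linarith [hc y hy, show w y = u y - inner ℝ p y from rfl]
  have h1 := (hn n hnx).1
  rwa [hga, hupa, huma, hp, real_inner_smul_left] at h1

/-- Neutrality determines the outward normal. -/
theorem IsNeutral.exists_normal_eq (hopen : IsOpen Ω) (hbdd : Bornology.IsBounded Ω)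
    (hconn : IsPreconnected Ω) (hC1 : HasC1Boundary Ω) (hσc : 0 < σc) (hσm : σm.PosDef)
    (h : IsNeutral Ω σc σm β) :
    ∃ c : E d, ∀ x ∈ frontier Ω, ∀ n, IsOutwardNormal Ω x n → 0 < β x ∧
      n = β x • (act (σm⁻¹ - σc⁻¹ • (1 : Matrix (Fin d) (Fin d) ℝ)) x - c) := by
  have hi : ∀ i : Fin d, ∃ c : ℝ, ∀ x ∈ frontier Ω, ∀ n, IsOutwardNormal Ω x n →
      β x * (x i - (σc⁻¹ * (act σm x) i + c)) = (act σm n) i := by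
    intro i
    obtain ⟨u, hu, hout⟩ := h.2 (EuclideanSpace.single i 1) (by simp)
    obtain ⟨c, hc⟩ := hu.eq_affine hopen hbdd hconn hC1 hσc hout
    refine ⟨c, fun x hx n hn => ?_⟩
    have := hc x hx n hn
    rw [inner_act_comm _ _ hσm.1, inner_act_comm _ _ hσm.1] at this
    simpa [EuclideanSpace.inner_single_left] using this
  choose c hc using hi
  -- The `d` scalar relations assemble to `σm n = β (x - σc⁻¹ σm x - c)`, which is then multiplied
  -- by `σm⁻¹`.
  refine ⟨act σm⁻¹ (WithLp.toLp 2 c), fun x hx n hn => ?_⟩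
  have hvec : β x • (x - (σc⁻¹ • act σm x + WithLp.toLp 2 c)) = act σm n := by
    ext i
    simpa using hc i x hx n hn
  have heq : n = β x • (act (σm⁻¹ - σc⁻¹ • (1 : Matrix (Fin d) (Fin d) ℝ)) x -
      act σm⁻¹ (WithLp.toLp 2 c)) := by
    rw [← hσm.act_inv_act n, ← hvec, act_smul, act_sub, act_add, act_smul, hσm.act_inv_act,
      sub_act, smul_act, one_act, sub_sub]
  refine ⟨lt_of_le_of_ne (h.1 x hx) fun h0 => hn.ne_zero ?_, heq⟩
  rw [heq, ← h0, zero_smul]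

/-- Under a definite contrast, neutrality forces the core to be the better conductor, and the
outward normal to be that of a concentric ellipsoid. -/
theorem IsNeutral.exists_center [Nontrivial (E d)] (hopen : IsOpen Ω)
    (hbdd : Bornology.IsBounded Ω) (hne : Ω.Nonempty) (hconn : IsPreconnected Ω)
    (hC1 : HasC1Boundary Ω) (hσc : 0 < σc) (hσm : σm.PosDef) (hcd : IsContrastDefinite σc σm)
    (h : IsNeutral Ω σc σm β) :
    (σc • (1 : Matrix (Fin d) (Fin d) ℝ) - σm).PosDef ∧
      ∃ x₀ : E d, ∀ x ∈ frontier Ω, ∀ n, IsOutwardNormal Ω x n → 0 < β x ∧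
        n = β x • act (σm⁻¹ - σc⁻¹ • (1 : Matrix (Fin d) (Fin d) ℝ)) (x - x₀) := by
  obtain ⟨c, hc⟩ := h.exists_normal_eq hopen hbdd hconn hC1 hσc hσm
  rcases hcd with hpos | hneg
  · exfalso
    have hB := posDef_sub_inv hσc hσm hpos
    set B := σc⁻¹ • (1 : Matrix (Fin d) (Fin d) ℝ) - σm⁻¹ with hBdef
    -- Completing the center turns the relation into `n = -β B (x - x₀)` with `B` positive definite,
    -- a normal pointing towards `x₀`.
    refine not_forall_inner_neg (x₀ := -act B⁻¹ c) hopen hbdd hne fun x hx => ?_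
    obtain ⟨n, hn⟩ := hC1.exists_isOutwardNormal hx
    obtain ⟨hβ, hnx⟩ := hc x hx n hn
    have hnB : n = -(β x • act B (x - -act B⁻¹ c)) := by
      rw [hnx, sub_neg_eq_add, act_add, hB.act_act_inv, hBdef, ← neg_sub, sub_act, sub_act]
      module
    have hx0 : x - -act B⁻¹ c ≠ 0 := fun h0 => hn.ne_zero (by
      rw [hnB, h0, act_zero, smul_zero, neg_zero])
    refine ⟨n, hn, ?_⟩
    rw [hnB, inner_neg_left, real_inner_smul_left, real_inner_comm, neg_lt_zero]
    exact mul_pos hβ (hB.inner_act_pos hx0)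
  · have hA := posDef_inv_sub hσc hσm hneg
    refine ⟨hneg, act (σm⁻¹ - σc⁻¹ • (1 : Matrix (Fin d) (Fin d) ℝ))⁻¹ c, fun x hx n hn => ?_⟩
    rw [act_sub _ x, hA.act_act_inv]
    exact hc x hx n hn

end Neutral

/-! ### Neutral ellipsoids -/

section Converse

variable {d : ℕ} {σc : ℝ} {σm A : Matrix (Fin d) (Fin d) ℝ} {x₀ : E d} {t : ℝ}

/-- One quadratic polynomial serves at every boundary point; lying outside the set keeps `x` away
from the center, the only zero of its gradient. -/
theorem isLocalDefining_ellipsoid (hA : A.PosDef) (ht : 0 < t) {x : E d}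
    (hx : x ∉ ellipsoid x₀ (t • A)) :
    IsLocalDefining (ellipsoid x₀ (t • A)) x
      (fun y => t * inner ℝ (y - x₀) (act A (y - x₀)) - 1) univ ∧
    gradient (fun y => t * inner ℝ (y - x₀) (act A (y - x₀)) - 1) x =
      (2 * t) • act A (x - x₀) ∧ act A (x - x₀) ≠ 0 := by
  have hne : act A (x - x₀) ≠ 0 := fun h0 => hx (by
    simp [ellipsoid, smul_act, h0])
  have hgrad : gradient (fun y => t * inner ℝ (y - x₀) (act A (y - x₀)) - 1) x =
      (2 * t) • act A (x - x₀) := by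
    refine HasGradientAt.gradient (hasGradientAt_iff_hasFDerivAt.2 ?_)
    have h1 : HasFDerivAt (fun y : E d => y - x₀) (ContinuousLinearMap.id ℝ (E d)) x :=
      (hasFDerivAt_id x).sub_const x₀
    refine ((((hasFDerivAt_inner_act hA.1 (x - x₀)).comp x h1).const_mul t).sub_const 1).congr_fderiv
      ?_
    ext v
    simp
    ring
  refine ⟨⟨isOpen_univ, mem_univ x, ?_, ?_, ?_⟩, hgrad, hne⟩
  · have h1 : ContDiff ℝ 1 (act A) := by
      rw [act_eq_toEuclideanCLM]
      exact (Matrix.toEuclideanCLM (𝕜 := ℝ) A).contDiff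
    have h2 : ContDiff ℝ 1 fun y : E d => y - x₀ := contDiff_id.sub contDiff_const
    exact ((contDiff_const.mul (h2.inner ℝ (h1.comp h2))).sub contDiff_const).contDiffOn
  · rw [hgrad]
    exact smul_ne_zero (by positivity) hne
  · ext y
    simp [ellipsoid, smul_act, real_inner_smul_right]

theorem normal_ellipsoid (hA : A.PosDef) (ht : 0 < t) (hopen : IsOpen (ellipsoid x₀ (t • A)))
    {x n : E d} (hx : x ∈ frontier (ellipsoid x₀ (t • A)))
    (hn : IsOutwardNormal (ellipsoid x₀ (t • A)) x n) :
    n = ‖act A (x - x₀)‖⁻¹ • act A (x - x₀) := by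
  have hx' : x ∉ ellipsoid x₀ (t • A) := by
    rw [hopen.frontier_eq] at hx
    exact hx.2
  obtain ⟨h1, h2, h3⟩ := isLocalDefining_ellipsoid hA ht hx'
  rw [hn.unique ⟨_, _, h1, rfl⟩ hopen hx, h2, norm_smul, Real.norm_of_nonneg (by positivity),
    smul_smul]
  congr 1
  have := norm_pos_iff.2 h3
  field_simp

theorem exists_isNeutral_ellipsoid {Ω : Set (E d)} (hopen : IsOpen Ω)
    (hbdd : Bornology.IsBounded Ω) (hσc : 0 < σc) (hσm : σm.PosDef)
    (h : (σc • (1 : Matrix (Fin d) (Fin d) ℝ) - σm).PosDef) (ht : 0 < t)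
    (hΩ : Ω = ellipsoid x₀ (t • (σm⁻¹ - σc⁻¹ • (1 : Matrix (Fin d) (Fin d) ℝ)))) :
    ∃ β, IsNeutral Ω σc σm β := by
  classical
  have hA := posDef_inv_sub hσc hσm h
  set A := σm⁻¹ - σc⁻¹ • (1 : Matrix (Fin d) (Fin d) ℝ) with hAdef
  -- This `β` normalizes `A (x - x₀)` to the unit normal. The constant `c` below makes the jump of
  -- `u` equal to `(a - p)·(x - x₀)`.
  refine ⟨fun x => ‖act A (x - x₀)‖⁻¹, fun x _ => by positivity, fun a _ => ?_⟩
  set p := σc⁻¹ • act σm a with hp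
  set c : ℝ := inner ℝ (a - p) x₀ with hc
  set u : E d → ℝ := fun x => if x ∈ Ω then inner ℝ p x + c else inner ℝ a x + 0 with hu
  have hin : ∀ x ∈ Ω, u =ᶠ[𝓝 x] fun y => inner ℝ p y + c := fun x hx => by
    filter_upwards [hopen.mem_nhds hx] with y hy using if_pos hy
  have hext : ∀ x ∈ ext Ω, u =ᶠ[𝓝 x] fun y => inner ℝ a y + 0 := fun x hx => by
    filter_upwards [(isOpen_ext Ω).mem_nhds hx] with y hy
      using if_neg fun h => hy (subset_closure h)
  have hgin : ∀ x ∈ Ω, gradient u x = p := fun x hx =>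
    ((hasGradientAt_inner_add p c x).congr_of_eventuallyEq (hin x hx)).gradient
  have hgext : ∀ x ∈ ext Ω, gradient u x = a := fun x hx =>
    ((hasGradientAt_inner_add a 0 x).congr_of_eventuallyEq (hext x hx)).gradient
  have hcd : ∀ (q : E d) (b : ℝ), ContDiff ℝ 2 fun y => inner ℝ q y + b := fun q b =>
    (innerSL ℝ q).contDiff.add contDiff_const
  refine ⟨u, ⟨?_, ?_, ?_, ?_⟩, fun x hx => by rw [hu]; simp only [if_neg hx, add_zero]⟩
  · rintro x (hx | hx)
    · exact ((hcd p c).contDiffAt.congr_of_eventuallyEq (hin x hx)).contDiffWithinAt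
    · exact ((hcd a 0).contDiffAt.congr_of_eventuallyEq (hext x hx)).contDiffWithinAt
  · rintro x (hx | hx)
    · have : (fun y => act (conductivity Ω σc σm y) (gradient u y)) =ᶠ[𝓝 x]
          fun _ => act (σc • 1) p := by
        filter_upwards [hopen.mem_nhds hx] with y hy
        rw [conductivity, if_pos hy, hgin y hy]
      rw [div_congr this, div_const]
    · have : (fun y => act (conductivity Ω σc σm y) (gradient u y)) =ᶠ[𝓝 x]
          fun _ => act σm a := by
        filter_upwards [(isOpen_ext Ω).mem_nhds hx] with y hy
        rw [conductivity, if_neg fun h => hy (subset_closure h), hgext y hy]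
      rw [div_congr this, div_const]
  · intro x hx
    refine ⟨inner ℝ p x + c, inner ℝ a x + 0, p, a, ?_, ?_, ?_, ?_, fun n hn => ?_⟩
    · refine (((hcd p c).continuous.tendsto x).mono_left nhdsWithin_le_nhds).congr' ?_
      filter_upwards [self_mem_nhdsWithin] with y hy using (hin y hy).eq_of_nhds.symm
    · refine (((hcd a 0).continuous.tendsto x).mono_left nhdsWithin_le_nhds).congr' ?_
      filter_upwards [self_mem_nhdsWithin] with y hy using (hext y hy).eq_of_nhds.symm
    · refine tendsto_const_nhds.congr' ?_
      filter_upwards [self_mem_nhdsWithin] with y hy using (hgin y hy).symm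
    · refine tendsto_const_nhds.congr' ?_
      filter_upwards [self_mem_nhdsWithin] with y hy using (hgext y hy).symm
    · have hnx : n = ‖act A (x - x₀)‖⁻¹ • act A (x - x₀) := by
        subst hΩ
        exact normal_ellipsoid hA ht hopen hx hn
      constructor
      · have h1 : inner ℝ a x + 0 - (inner ℝ p x + c) = inner ℝ (a - p) (x - x₀) := by
          rw [hc, inner_sub_left, inner_sub_left, inner_sub_right, inner_sub_right]
          ring
        -- Since `σm A = I - σc⁻¹ σm`, the exterior flux is `β` times the jump.
        have h2 : inner ℝ (act σm a) (act A (x - x₀)) = inner ℝ (a - p) (x - x₀) := by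
          rw [hAdef, sub_act, smul_act, one_act, inner_sub_right, inner_act_comm _ (act σm⁻¹ _) hσm.1,
            hσm.act_act_inv, inner_sub_left, hp, real_inner_smul_left, real_inner_smul_right]
        rw [h1, hnx, real_inner_smul_right, h2]
      · rw [hp, real_inner_smul_left, mul_inv_cancel_left₀ hσc.ne']
  · refine (isBigO_zero _ _).congr' ?_ EventuallyEq.rfl
    have : ∀ᶠ x in Bornology.cobounded (E d), x ∈ Ωᶜ := hbdd
    filter_upwards [this] with x hx
    rw [hu]
    simp only [if_neg hx, add_zero, sub_self]

end Converse

/-! ### Characterization of neutral domains and the isotropic case -/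

theorem IsNeutral.exists_eq_ellipsoid {d : ℕ} (hd : 2 ≤ d) {Ω : Set (E d)} {σc : ℝ}
    {σm : Matrix (Fin d) (Fin d) ℝ} {β : E d → ℝ} (hopen : IsOpen Ω)
    (hbdd : Bornology.IsBounded Ω) (hne : Ω.Nonempty) (hconn : IsPreconnected Ω)
    (hC1 : HasC1Boundary Ω) (hσc : 0 < σc) (hσm : σm.PosDef) (hcd : IsContrastDefinite σc σm)
    (h : IsNeutral Ω σc σm β) :
    (σc • (1 : Matrix (Fin d) (Fin d) ℝ) - σm).PosDef ∧ ∃ (x₀ : E d) (t : ℝ), 0 < t ∧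
      Ω = ellipsoid x₀ (t • (σm⁻¹ - σc⁻¹ • (1 : Matrix (Fin d) (Fin d) ℝ))) ∧
      ∀ x ∈ frontier Ω, ∃ n, IsOutwardNormal Ω x n ∧ 0 < β x ∧
        n = β x • act (σm⁻¹ - σc⁻¹ • (1 : Matrix (Fin d) (Fin d) ℝ)) (x - x₀) := by
  have : Nontrivial (Fin d) := Fin.nontrivial_iff_two_le.2 hd
  obtain ⟨hneg, x₀, hx₀⟩ := h.exists_center hopen hbdd hne hconn hC1 hσc hσm hcd
  have hn : ∀ x ∈ frontier Ω, ∃ n, IsOutwardNormal Ω x n ∧ 0 < β x ∧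
      n = β x • act (σm⁻¹ - σc⁻¹ • (1 : Matrix (Fin d) (Fin d) ℝ)) (x - x₀) := fun x hx => by
    obtain ⟨n, hn⟩ := hC1.exists_isOutwardNormal hx
    exact ⟨n, hn, hx₀ x hx n hn⟩
  obtain ⟨t, ht, hΩ⟩ := eq_ellipsoid (x₀ := x₀) hd hopen hbdd hne (posDef_inv_sub hσc hσm hneg)
    fun x hx => by
      obtain ⟨n, hnx, hβ, hne⟩ := hn x hx
      exact ⟨n, hnx, β x, hβ, hne⟩
  exact ⟨hneg, x₀, t, ht, hΩ, hn⟩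

theorem isContrastDefinite_smul_one {d : ℕ} {s σc : ℝ} (h : s ≠ σc) :
    IsContrastDefinite σc (s • (1 : Matrix (Fin d) (Fin d) ℝ)) := by
  unfold IsContrastDefinite
  rw [← sub_smul, ← sub_smul]
  rcases h.lt_or_gt with h | h
  · exact Or.inr (Matrix.PosDef.one.smul (sub_pos.2 h))
  · exact Or.inl (Matrix.PosDef.one.smul (sub_pos.2 h))

/-- Isotropic conductivities are neutral for balls only, with constant interface parameter. -/
theorem IsNeutral.eq_ball {d : ℕ} (hd : 2 ≤ d) {Ω : Set (E d)} {σc s : ℝ} {β : E d → ℝ}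
    (hopen : IsOpen Ω) (hbdd : Bornology.IsBounded Ω) (hne : Ω.Nonempty)
    (hconn : IsPreconnected Ω) (hC1 : HasC1Boundary Ω) (hσc : 0 < σc) (hs : 0 < s) (hsc : s ≠ σc)
    (h : IsNeutral Ω σc (s • (1 : Matrix (Fin d) (Fin d) ℝ)) β) :
    (∃ (x₀ : E d) (r : ℝ), 0 < r ∧ Ω = Metric.ball x₀ r) ∧
      ∃ b : ℝ, ∀ x ∈ frontier Ω, β x = b := by
  have hσm : (s • (1 : Matrix (Fin d) (Fin d) ℝ)).PosDef := Matrix.PosDef.one.smul hs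
  obtain ⟨hneg, x₀, t, ht, hΩ, hn⟩ := h.exists_eq_ellipsoid hd hopen hbdd hne hconn hC1 hσc hσm
    (isContrastDefinite_smul_one hsc)
  have hA := posDef_inv_sub hσc hσm hneg
  have hact : ∀ v : E d, act ((s • (1 : Matrix (Fin d) (Fin d) ℝ))⁻¹ -
      σc⁻¹ • (1 : Matrix (Fin d) (Fin d) ℝ)) v = (s⁻¹ - σc⁻¹) • v := fun v => by
    have h1 : act (s • (1 : Matrix (Fin d) (Fin d) ℝ)) (s⁻¹ • v) = v := by
      rw [smul_act, one_act, smul_inv_smul₀ hs.ne']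
    rw [sub_act, smul_act, one_act, sub_smul]
    conv_lhs => rw [← h1, hσm.act_inv_act, h1]
  set k := s⁻¹ - σc⁻¹ with hk
  have hk0 : 0 < k := by
    have : Nontrivial (Fin d) := Fin.nontrivial_iff_two_le.2 hd
    obtain ⟨v, hv⟩ := exists_ne (0 : E d)
    have := hA.inner_act_pos hv
    rw [hact, real_inner_smul_right] at this
    exact pos_of_mul_pos_left this real_inner_self_nonneg
  have htk : 0 < t * k := mul_pos ht hk0
  set r := (√(t * k))⁻¹ with hr
  have hr0 : 0 < r := inv_pos.2 (Real.sqrt_pos.2 htk)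
  have hball : Ω = Metric.ball x₀ r := by
    rw [hΩ]
    ext x
    rw [ellipsoid, mem_ofPred_eq, smul_act, hact, real_inner_smul_right, real_inner_smul_right,
      real_inner_self_eq_norm_sq, Metric.mem_ball, dist_eq_norm, hr, ← mul_assoc, inv_eq_one_div,
      lt_div_iff₀ (Real.sqrt_pos.2 htk), ← sq_lt_one_iff₀ (a := ‖x - x₀‖ * √(t * k)) (by positivity),
      mul_pow, Real.sq_sqrt htk.le, mul_comm]
  -- Taking norms in `n = β k (x - x₀)` on the sphere of radius `r` gives `β k r = 1`.
  refine ⟨⟨x₀, r, hr0, hball⟩, (k * r)⁻¹, fun x hx => ?_⟩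
  obtain ⟨n, hnx, hβ, hne⟩ := hn x hx
  have hxr : ‖x - x₀‖ = r := by
    rw [hball, frontier_ball x₀ hr0.ne'] at hx
    rwa [← dist_eq_norm]
  have h1 := hnx.norm_eq_one
  rw [hne, hact, norm_smul, norm_smul, Real.norm_of_nonneg hβ.le, Real.norm_of_nonneg hk0.le,
    hxr] at h1
  exact eq_inv_of_mul_eq_one_left h1

end LCInterface

theorem theorem6p1 (d : ℕ) (hd : d = 2 ∨ d = 3) (Ω : Set (LCInterface.E d))
    (hopen : IsOpen Ω) (hbdd : Bornology.IsBounded Ω) (hsc : SimplyConnectedSpace Ω)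
    (hC1 : LCInterface.HasC1Boundary Ω) (σc : ℝ) (hσc : 0 < σc) :
    -- neutrality for some matrix conductivity and some interface parameter
    ((∃ σm : Matrix (Fin d) (Fin d) ℝ, σm.PosDef ∧ LCInterface.IsContrastDefinite σc σm ∧
        ∃ β : LCInterface.E d → ℝ, LCInterface.IsNeutral Ω σc σm β) ↔
      LCInterface.IsEllipsoid Ω) ∧
    -- neutrality for a prescribed matrix conductivity and some interface parameter
    (∀ σm : Matrix (Fin d) (Fin d) ℝ, σm.PosDef → LCInterface.IsContrastDefinite σc σm →
      ((∃ β : LCInterface.E d → ℝ, LCInterface.IsNeutral Ω σc σm β) ↔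
        (σc • (1 : Matrix (Fin d) (Fin d) ℝ) - σm).PosDef ∧
          ∃ (x₀ : LCInterface.E d) (t : ℝ), 0 < t ∧
            Ω = LCInterface.ellipsoid x₀
              (t • (σm⁻¹ - σc⁻¹ • (1 : Matrix (Fin d) (Fin d) ℝ))))) ∧
    -- isotropic matrix conductivity: only disks and balls, with constant interface parameter
    (∀ s : ℝ, 0 < s → s ≠ σc → ∀ β : LCInterface.E d → ℝ,
      LCInterface.IsNeutral Ω σc (s • (1 : Matrix (Fin d) (Fin d) ℝ)) β →
        (∃ (x₀ : LCInterface.E d) (r : ℝ), 0 < r ∧ Ω = Metric.ball x₀ r) ∧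
          ∃ b : ℝ, ∀ x ∈ frontier Ω, β x = b) := by
  have hd2 : 2 ≤ d := by omega
  have hconn : IsConnected Ω := isConnected_iff_connectedSpace.2 inferInstance
  have hne := hconn.nonempty
  have hpre := hconn.isPreconnected
  refine ⟨⟨?_, ?_⟩, fun σm hσm hcd => ⟨?_, ?_⟩, fun s hs hsc β hβ => ?_⟩
  · rintro ⟨σm, hσm, hcd, β, hβ⟩
    obtain ⟨hneg, x₀, t, ht, hΩ, -⟩ :=
      hβ.exists_eq_ellipsoid hd2 hopen hbdd hne hpre hC1 hσc hσm hcd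
    exact ⟨x₀, _, (LCInterface.posDef_inv_sub hσc hσm hneg).smul ht, hΩ⟩
  · rintro ⟨x₀, P, hP, hΩ⟩
    -- The conductivity is the inverse of this matrix, so that `σm⁻¹ - σc⁻¹ I` is exactly `P`.
    have hM : (σc⁻¹ • (1 : Matrix (Fin d) (Fin d) ℝ) + P).PosDef :=
      (Matrix.PosDef.one.smul (inv_pos.2 hσc)).add hP
    have hneg := LCInterface.posDef_sub_inv (inv_pos.2 hσc) hM (by rwa [add_sub_cancel_left])
    rw [inv_inv] at hneg
    refine ⟨_, hM.inv, Or.inr hneg, ?_⟩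
    refine LCInterface.exists_isNeutral_ellipsoid (x₀ := x₀) (t := 1) hopen hbdd hσc hM.inv hneg
      one_pos ?_
    rw [Matrix.nonsing_inv_nonsing_inv _ ((Matrix.isUnit_iff_isUnit_det _).1 hM.isUnit),
      add_sub_cancel_left, one_smul, hΩ]
  · rintro ⟨β, hβ⟩
    obtain ⟨hneg, x₀, t, ht, hΩ, -⟩ :=
      hβ.exists_eq_ellipsoid hd2 hopen hbdd hne hpre hC1 hσc hσm hcd
    exact ⟨hneg, x₀, t, ht, hΩ⟩
  · rintro ⟨hneg, x₀, t, ht, hΩ⟩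
    exact LCInterface.exists_isNeutral_ellipsoid hopen hbdd hσc hσm hneg ht hΩ
  · exact hβ.eq_ball hd2 hopen hbdd hne hpre hC1 hσc hs hsc
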